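/- **Setting.** Graphs are finite, undirected, without loops, possibly with multiple edges; a path from $v_0$ to $v_k$ is an alternating sequence $[v_0,e_1,v_1,\dots,e_k,v_k]$ in which $e_i$ has endpoints $v_{i-1},v_i$. A *simple iterated graph system* consists of a connected graph $G_1=(V_1,E_1)$, a finite non-empty set $I$, injective maps $\phi_-,\phi_+\colon I\to V_1$ with images $I_\pm=\phi_\pm(I)$, and a labelling $e^-,e^+$ of the two endpoints of every edge $e\in E_1$, such that $I_-\cap I_+=\varnothing$ and no edge has both endpoints in $I_-$ or both in $I_+$. The graphs $G_n=(V_n,E_n)$ are defined by $E_{n+1}=E_1\times E_n$, $V_{n+1}=(V_1\times E_n)/\!\sim$, where $(\phi_s(i),f)\sim(\phi_t(i),g)$ whenever $i\in I$, $s,t\in\{-,+\}$, $f,g\in E_n$ and $f^s=g^t$; the edge $(e,f)$ has endpoints $(e,f)^\pm=[e^\pm,f]$. Let $\pi(e,f)=f$. Write $e\cap f\neq\varnothing$ if $e,f\in E_n$ share an endpoint. Let $\Sigma$ be the set of sequences $(e_n)_{n\ge1}$ with $e_n\in E_n$, $\pi(e_{n+1})=e_n$, and let $X=\Sigma/\!\sim$,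 where $(e_n)\sim(f_n)$ iff $e_n\cap f_n\ne\varnothing$ for all $n$. Let $T\colon E_1^{\mathbb N}\to\Sigma$ be the bijection $T(w)=(e_n)$, $e_1=w_1$, $e_{n+1}=(w_{n+1},e_n)$, and $\chi\colon\Sigma\to X$ the quotient map. Assume that the system is *doubling* (every vertex of $I_-\cup I_+$ has degree $1$), *non-degenerate* (no edge joins $I_-$ to $I_+$) and *symmetric*, with a fixed graph isomorphism $\eta\colon G_1\to G_1$ (a bijection on vertices and a bijection on edges, compatible with endpoints) satisfying $\eta\circ\phi_\pm=\phi_\mp$. A function $\rho\colon E_1\to(0,1)$ is a *symmetric $\Theta^{(1)}$-admissible density* if $\rho(\eta(e))=\rho(e)$ for all $e\in E_1$ and $\sum_{i=1}^k\rho(e_i)\ge1$ for every path $[v_0,e_1,\dots,e_k,v_k]$ in $G_1$ with $v_0\in I_-$, $v_k\in I_+$. For such $\rho$ put $\rho_1=\rho$ and $\rho_{n+1}(e,f)=\rho(e)\rho_n(f)$. For distinct $v,w\in V_n$ let $d_{\rho,n}(v,w)$ be the infimum of $\sum_{e\in\Omega}\rho_{|e|}(e)$ (with $|e|=k$ for $e\in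 E_k$) over all $\Omega\subset\bigcup_{k=1}^nE_k$ for which $v$ and $w$ are joined by a path in $G_n$ each of whose edges is mapped into $\Omega$ by some iterate $\pi^j$, $j\geq 0$; put $d_{\rho,n}(v,v)=0$, and $d_{\rho,n}(e,f)=\min\{d_{\rho,n}(v,w): v\in\{e^-,e^+\},\,w\in\{f^-,f^+\}\}$ for $e,f\in E_n$. **Theorem.** (1) For every symmetric $\Theta^{(1)}$-admissible density $\rho\colon E_1\to(0,1)$ the equation $\sum_{e\in E_1}\rho(e)^Q=1$ has a unique real solution $Q$, and $Q\ge1$. There is a (necessarily unique) metric $d_\rho$ on $X$ such that $$d_\rho\big([(e_n)],[(f_n)]\big)=\lim_{n\to\infty}d_{\rho,n}(e_n,f_n)\qquad\text{for all }(e_n),(f_n)\in\Sigma ,$$ and $(X,d_\rho)$ is $Q$-Ahlfors regular: there are a Radon measure $\mu$ and $C\ge1$ with $C^{-1}r^Q\le\mu(B(x,r))\le Cr^Q$ for all $x\in X$, $0<r\le2\operatorname{diam}(X,d_\rho)$. One may take for $\mu$ the push-forward under $\chi\circ T$ of the product measure on $E_1^{\mathbb N}$ each of whose factors gives mass $\rho(e)^Q$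 to $e\in E_1$. (2) For any two symmetric $\Theta^{(1)}$-admissible densities $\rho,\nu\colon E_1\to(0,1)$ the metrics $d_\rho$ and $d_\nu$ are quasisymmetrically equivalent: the identity $(X,d_\rho)\to(X,d_\nu)$ is a homeomorphism, and there is a homeomorphism $\theta\colon[0,\infty)\to[0,\infty)$ with $$\frac{d_\nu(x,y)}{d_\nu(x,z)}\le\theta\!\left(\frac{d_\rho(x,y)}{d_\rho(x,z)}\right)\qquad\text{for all }x,y,z\in X,\ x\ne z .$$ -/

import Mathlib

open MeasureTheory Filter Topology
open scoped NNReal ENNReal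

universe u

/-- A multigraph in which the two endpoints of every edge `e` carry labels:
`endpt false e` is `e⁻` and `endpt true e` is `e⁺`. As a graph it is undirected:
its endpoint map is `OGraph.ends`. -/
structure OGraph where
  V : Type u
  E : Type u
  endpt : Bool → E → V

namespace OGraph

variable (G : OGraph.{u})

/-- The endpoint map `ξ(e) = {e⁻, e⁺}`. -/
def ends (e : G.E) : Sym2 G.V := s(G.endpt false e, G.endpt true e)

/-- `IsPath G v [e₁, …, e_k] w`: there is a path `[v, e₁, v₁, …, e_k, w]` from `v` to `w`
(with `ξ(e_i) = {v_{i-1}, v_i}`; vertices and edges may repeat). -/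
def IsPath : G.V → List G.E → G.V → Prop
  | v, [], w => v = w
  | v, e :: l, w => ∃ u, G.ends e = s(v, u) ∧ IsPath u l w

/-- Any two vertices are joined by a path. -/
def Connected : Prop := ∀ v w, ∃ l, G.IsPath v l w

/-- The edges `e` and `f` share an endpoint: `e ∩ f ≠ ∅`. -/
def Adjacent (e f : G.E) : Prop := ∃ s t, G.endpt s e = G.endpt t f

/-- The number of edges having `v` as an endpoint. -/
noncomputable def degree (v : G.V) : ℕ := Set.ncard {e | ∃ s, G.endpt s e = v}

end OGraph

/-- A simple iterated graph system: a finite connected generator `G₁` (multiple edges allowed, no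
loops), a finite nonempty gluing set `I` and two gluing maps `φ₋ = φ false`, `φ₊ = φ true`.
The endpoint labels of an edge `e` are such that the gluing maps of the IGS are
`φ_{e⁻,e} = φ₋` and `φ_{e⁺,e} = φ₊`. -/
structure SimpleIGS where
  /-- the generator `G₁` -/
  gen : OGraph.{u}
  finite_V : Finite gen.V
  fintype_E : Fintype gen.E
  loopless : ∀ e, gen.endpt false e ≠ gen.endpt true e
  connected : gen.Connected
  I : Type u
  finite_I : Finite I
  nonempty_I : Nonempty I
  φ : Bool → I → gen.V
  injective_φ : ∀ s, Function.Injective (φ s)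
  /-- `I₋ ∩ I₊ = ∅` -/
  disjoint_φ : ∀ i j, φ false i ≠ φ true j
  /-- no edge has both endpoints in `I₋`, or both endpoints in `I₊` -/
  no_edge_φ : ∀ s e, ¬ ∀ t, gen.endpt t e ∈ Set.range (φ s)

namespace SimpleIGS

variable (S : SimpleIGS.{u})

instance : Fintype S.gen.E := S.fintype_E

/-- All subsets of the finite edge set are measurable. -/
instance : MeasurableSpace S.gen.E := ⊤

/-- The gluing sets `I₋ = gluingSet false`, `I₊ = gluingSet true`. -/
def gluingSet (s : Bool) : Set S.gen.V := Set.range (S.φ s)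

/-- Every vertex of `I₋ ∪ I₊` has degree one. -/
def Doubling : Prop := ∀ s, ∀ v ∈ S.gluingSet s, S.gen.degree v = 1

/-- No edge joins `I₋` to `I₊`. -/
def NonDegenerate : Prop :=
  ∀ e s, ¬ (S.gen.endpt false e ∈ S.gluingSet s ∧ S.gen.endpt true e ∈ S.gluingSet (!s))

/-- A symmetry map: a graph isomorphism `η : G₁ → G₁` (a bijection of the vertices and a bijection
of the edges, compatible with the endpoint map) with `η ∘ φ_± = φ_∓`. -/
structure Symmetry where
  onV : S.gen.V ≃ S.gen.V
  onE : S.gen.E ≃ S.gen.E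
  ends_onE : ∀ e, S.gen.ends (onE e) = (S.gen.ends e).map onV
  swap : ∀ s i, onV (S.φ s i) = S.φ (!s) i

/-! ### Replacement graphs -/

/-- The replacement step: every edge `f` of `G` is replaced by a copy `V₁ × {f}` of the generator;
whenever `f` and `g` share an endpoint, say `f^s = g^t`, the points `(φ_s(i), f)` and
`(φ_t(i), g)` are identified for every `i ∈ I`. The edge `(e, f)` has endpoints `[e^±, f]`, with
the labels (hence the gluing maps) inherited from `e`. -/
def replace (G : OGraph.{u}) : OGraph.{u} where
  V := Quot fun p q : S.gen.V × G.E =>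
    ∃ s t i, G.endpt s p.2 = G.endpt t q.2 ∧ p.1 = S.φ s i ∧ q.1 = S.φ t i
  E := S.gen.E × G.E
  endpt s e := Quot.mk _ (S.gen.endpt s e.1, e.2)

/-- The replacement graphs, indexed from zero: `S.graph n` is the graph `G_{n+1}`, so that
`S.graph 0` is the generator `G₁`. -/
def graph : ℕ → OGraph.{u}
  | 0 => S.gen
  | n + 1 => S.replace (graph n)

/-- The edges of `S.graph n`. -/
abbrev Edge (n : ℕ) : Type u := (S.graph n).E

variable {S}

/-- The projection `(e, f) ↦ f` from the edges of one level to those of the previous level. -/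
def parent {n : ℕ} (e : S.Edge (n + 1)) : S.Edge n :=
  Prod.snd (α := S.gen.E) (β := (S.graph n).E) e

/-- The last digit `e ∈ E₁` of the edge `(e, f)`. -/
def digit {n : ℕ} (e : S.Edge (n + 1)) : S.gen.E :=
  Prod.fst (α := S.gen.E) (β := (S.graph n).E) e

/-- The edge `(e, f)`, that is, `f · e`. -/
def child {n : ℕ} (e : S.gen.E) (f : S.Edge n) : S.Edge (n + 1) :=
  Prod.mk (α := S.gen.E) (β := (S.graph n).E) e f

/-- `Below k e n g`: the edge `g` (of level `n`) is mapped to the edge `e` (of level `k ≤ n`) by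
iterated projection; equivalently, `g` is an edge of the subgraph replacing `e`. -/
inductive Below {k : ℕ} (e : S.Edge k) : (n : ℕ) → S.Edge n → Prop
  | refl : Below e k e
  | step {n : ℕ} (g : S.Edge (n + 1)) : Below e n (parent g) → Below e (n + 1) g

variable (S)

/-- The symbol space `Σ`: sequences of edges `e_n` of `S.graph n` compatible with projection. -/
def Symbol : Type u := {x : ∀ n, S.Edge n // ∀ n, parent (x (n + 1)) = x n}

/-- Two symbols are identified when their edges share an endpoint at every level. -/
def symbolRel (x y : S.Symbol) : Prop := ∀ n, (S.graph n).Adjacent (x.1 n) (y.1 n)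

/-- The limit space `X = Σ / ∼`. (For a doubling and non-degenerate system `symbolRel` already is
an equivalence relation; in general the one that it generates is used.) -/
def LimitSpace : Type u := Quot S.symbolRel

/-- The canonical projection `χ : Σ → X`. -/
def proj (x : S.Symbol) : S.LimitSpace := Quot.mk _ x

/-- The edge `w₀ · w₁ · … · w_n` of `S.graph n`. -/
def word (w : ℕ → S.gen.E) : ∀ n, S.Edge n
  | 0 => w 0
  | n + 1 => child (w (n + 1)) (word w n)

/-- The bijection `T : E₁^ℕ → Σ`, `T(w) = (w₀ · … · w_n)_n`. -/
def ofWord (w : ℕ → S.gen.E) : S.Symbol := ⟨S.word w, fun _ => rfl⟩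

/-! ### Densities and metrics -/

/-- `ρ` is `Θ^{(1)}`-admissible: every path from `I₋` to `I₊` has `ρ`-length at least one. -/
def Admissible (ρ : S.gen.E → ℝ) : Prop :=
  ∀ v ∈ S.gluingSet false, ∀ w ∈ S.gluingSet true, ∀ l, S.gen.IsPath v l w → 1 ≤ (l.map ρ).sum

variable {S} in
/-- `ρ : E₁ → (0,1)` is a symmetric `Θ^{(1)}`-admissible density. -/
structure IsSymmetricAdmissible (η : S.Symmetry) (ρ : S.gen.E → ℝ) : Prop where
  mem_Ioo : ∀ e, ρ e ∈ Set.Ioo (0 : ℝ) 1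
  admissible : S.Admissible ρ
  symmetric : ∀ e, ρ (η.onE e) = ρ e

/-- The multiplicative cascade: the weight of an edge is the product of `ρ` over its digits. -/
def cascade (ρ : S.gen.E → ℝ) : ∀ n, S.Edge n → ℝ
  | 0, e => ρ e
  | n + 1, e => cascade ρ n (parent e) * ρ (digit e)

/-- The collection `Λ_{v,w}` at level `n`: finite sets `Ω` of edges of levels at most `n` such that
`v` and `w` are joined by a path all of whose edges lie in subgraphs replacing edges in `Ω`. -/
def chains (n : ℕ) (v w : (S.graph n).V) : Set (Finset (Σ k, S.Edge k)) :=
  {Ω | (∀ a ∈ Ω, a.1 ≤ n) ∧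
    ∃ l, (S.graph n).IsPath v l w ∧ ∀ g ∈ l, ∃ a ∈ Ω, Below a.2 n g}

open Classical in
/-- The metric `d_{ρ,n}` on the vertices of the `n`-th graph. -/
noncomputable def vertexDist (ρ : S.gen.E → ℝ) (n : ℕ) (v w : (S.graph n).V) : ℝ :=
  if v = w then 0
  else sInf ((fun Ω : Finset (Σ k, S.Edge k) => ∑ a ∈ Ω, S.cascade ρ a.1 a.2) '' S.chains n v w)

/-- `d_{ρ,n}(e, f)`: the least distance of an endpoint of `e` from an endpoint of `f`. -/
noncomputable def edgeDist (ρ : S.gen.E → ℝ) (n : ℕ) (e f : S.Edge n) : ℝ :=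
  ⨅ p : Bool × Bool, S.vertexDist ρ n ((S.graph n).endpt p.1 e) ((S.graph n).endpt p.2 f)

/-- `d` is the metric `d_ρ` on `X`, given by
`d_ρ([(e_n)], [(f_n)]) = lim_n d_{ρ,n}(e_n, f_n)` for all symbols `(e_n)`, `(f_n)`. There is at most
one such metric. -/
def IsLimitMetric (ρ : S.gen.E → ℝ) (d : MetricSpace S.LimitSpace) : Prop :=
  ∀ x y : S.Symbol,
    Tendsto (fun n => S.edgeDist ρ n (x.1 n) (y.1 n)) atTop (𝓝 (d.dist (S.proj x) (S.proj y)))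

/-- The law on `E₁` giving mass `ρ(e)^Q` to `e`. -/
noncomputable def letterLaw (ρ : S.gen.E → ℝ) (Q : ℝ) : Measure S.gen.E :=
  ∑ e, ENNReal.ofReal (ρ e ^ Q) • Measure.dirac e

/-- The push-forward to `X`, under `w ↦ χ(T(w))`, of the infinite product on `E₁^ℕ` of the law
`e ↦ ρ(e)^Q`; a Borel measure for the metric `d`. -/
noncomputable def limitMeasure (ρ : S.gen.E → ℝ) (Q : ℝ) (d : MetricSpace S.LimitSpace) :
    @Measure S.LimitSpace (@borel _ d.toUniformSpace.toTopologicalSpace) :=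
  @Measure.map _ _ _ (@borel _ d.toUniformSpace.toTopologicalSpace)
    (fun w => S.proj (S.ofWord w)) (Measure.infinitePi fun _ : ℕ => S.letterLaw ρ Q)

end SimpleIGS

/-! ### Metric geometry -/

/-- `μ` is a Radon measure on the metric space `(X, d)` with `C⁻¹ r^Q ≤ μ(B(x,r)) ≤ C r^Q` for all
`x` and all `0 < r ≤ 2 diam X`. -/
def IsAhlforsRegularMeasure {X : Type*} (d : MetricSpace X) (Q : ℝ)
    (μ : @Measure X (@borel X d.toUniformSpace.toTopologicalSpace)) : Prop :=
  letI := d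
  letI : MeasurableSpace X := borel X
  μ.Regular ∧ ∃ C : ℝ, 1 ≤ C ∧ ∀ (x : X) (r : ℝ), 0 < r →
    ENNReal.ofReal r ≤ 2 * Metric.ediam (Set.univ : Set X) →
      ENNReal.ofReal (C⁻¹ * r ^ Q) ≤ μ (Metric.ball x r) ∧
        μ (Metric.ball x r) ≤ ENNReal.ofReal (C * r ^ Q)

/-- The metric space `(X, d)` is `Q`-Ahlfors regular. -/
def IsAhlforsRegular {X : Type*} (d : MetricSpace X) (Q : ℝ) : Prop :=
  0 < Q ∧ ∃ μ, IsAhlforsRegularMeasure d Q μ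

/-- `f` is a quasisymmetry: a homeomorphism for which there is a homeomorphism `η` of `[0,∞)` with
`d(f x, f y) / d(f x, f z) ≤ η (d(x, y) / d(x, z))` whenever `x ≠ z`. -/
def IsQuasisymmetry {X Y : Type*} [MetricSpace X] [MetricSpace Y] (f : X → Y) : Prop :=
  IsHomeomorph f ∧ ∃ η : ℝ≥0 ≃ₜ ℝ≥0, ∀ x y z : X, x ≠ z →
    nndist (f x) (f y) / nndist (f x) (f z) ≤ η (nndist x y / nndist x z)

/-- Two metrics on `X` are quasisymmetrically equivalent: the identity is a quasisymmetry. -/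
def QuasisymmetricallyEquivalent {X : Type*} (d d' : MetricSpace X) : Prop :=
  @IsQuasisymmetry X X d d' id

/-!
The whole argument compares edges and paths of one level with those of the next.

*Refinement and coarsening.* A path at level `n` through a set of edges refines to paths at all later
levels through their descendants (`linked_refine`), so that the distance of two symbols can grow
after level `n` by at most the weights of their two edges (`edgeDist_le_add`). Conversely, follow a
path at level `n + 1` and record which copies of the generator it crosses from one side to the other
(`linked_coarsen`). By admissibility the children used in crossing the copy that replaces `q` weigh
at least as much as `q` itself, so that `q` can be used in their place: distances do not decrease
with the level (`edgeDist_parent_le`). Hence `d_{ρ,n}(e_n, f_n)` increases to a finite limit, and the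
triangle inequality, which at level `n` has an error equal to the weight of the middle edge,
becomes exact in the limit.

*Adjacent edges.* By symmetry and doubling, adjacent edges have comparable weights
(`cascade_comparable`): once the two words have separated, their digits sit at the vertices
`φ_s(i)` and `φ_t(i)` for a common `i`, so that these digits have equal weights. A path from `e` to a
non-adjacent edge starts with an edge adjacent to `e`, whence its length is bounded below by a
multiple of the weight of `e` (`le_edgeDist_of_not_adjacent`). This makes the limit a metric and shows
that the distance of two points is comparable to the weight of an edge at the first level where
their edges are not adjacent (`IsLimitMetric.dist_comparable`).

*Ahlfors regularity.* The product measure gives to the cylinder of `e` the mass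
`ρ(e)^Q`. A ball of radius `r` contains a cylinder of weight comparable to `r`, and it is contained in
the cylinders of the edges adjacent to one edge of weight comparable to `r`. There are at most
`2|E₁|` of these, because doubling keeps the vertex degrees bounded (`exists_injOn_edges_at`).

*Quasisymmetry.* The first level of non-adjacency does not depend on the density. Choosing exponents
with `ν ≤ ρ^α` and `ρ^β ≤ ν` on `E₁`, the ratio of the `ν`-weights at two levels of a symbol is at most
the sum of the powers `α` and `β` of the ratio of the `ρ`-weights (`cascade_div_cascade_le`), and
the identity is a power quasisymmetry.
-/

/-! ### Linked vertices -/

namespace OGraph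

variable {G : OGraph.{u}}

/-- The vertices `v` and `w` are joined by a path of `G` all of whose edges lie in `A`. -/
def Linked (A : Set G.E) : G.V → G.V → Prop :=
  Relation.ReflTransGen fun v w => ∃ e ∈ A, ∃ s, G.endpt s e = v ∧ G.endpt (!s) e = w

theorem ends_eq_iff {e : G.E} {v w : G.V} :
    G.ends e = s(v, w) ↔ ∃ s, G.endpt s e = v ∧ G.endpt (!s) e = w := by
  simp only [ends, Sym2.eq_iff, Bool.exists_bool, Bool.not_false, Bool.not_true]
  tauto

theorem Linked.refl {A : Set G.E} (v : G.V) : Linked A v v := Relation.ReflTransGen.refl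

theorem Linked.trans {A : Set G.E} {u v w : G.V} (h : Linked A u v) (h' : Linked A v w) :
    Linked A u w := Relation.ReflTransGen.trans h h'

theorem Linked.mono {A B : Set G.E} (hAB : A ⊆ B) {v w : G.V} (h : Linked A v w) :
    Linked B v w :=
  Relation.ReflTransGen.mono (fun _ _ ⟨e, he, s, h⟩ => ⟨e, hAB he, s, h⟩) v w h

theorem Linked.symm {A : Set G.E} {v w : G.V} (h : Linked A v w) : Linked A w v := by
  have : Std.Symm fun v w => ∃ e ∈ A, ∃ s, G.endpt s e = v ∧ G.endpt (!s) e = w :=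
    ⟨fun _ _ ⟨e, he, s, h₁, h₂⟩ => ⟨e, he, !s, h₂, by simpa using h₁⟩⟩
  exact Relation.ReflTransGen.stdSymm.symm _ _ h

theorem linked_endpt {A : Set G.E} {e : G.E} (he : e ∈ A) (s t : Bool) :
    Linked A (G.endpt s e) (G.endpt t e) := by
  by_cases h : t = s
  · subst h; exact Linked.refl _
  · obtain rfl : t = !s := by cases s <;> cases t <;> simp_all
    exact Relation.ReflTransGen.single ⟨e, he, s, rfl, rfl⟩

theorem linked_iff_isPath {A : Set G.E} {v w : G.V} :
    Linked A v w ↔ ∃ l, G.IsPath v l w ∧ ∀ e ∈ l, e ∈ A := by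
  constructor
  · intro h
    induction h using Relation.ReflTransGen.head_induction_on with
    | refl => exact ⟨[], rfl, by simp⟩
    | head hstep _ ih =>
      obtain ⟨e, he, s, hs⟩ := hstep
      obtain ⟨l, hl, hA⟩ := ih
      exact ⟨e :: l, ⟨_, ends_eq_iff.2 ⟨s, hs⟩, hl⟩, by simpa using ⟨he, hA⟩⟩
  · rintro ⟨l, hl, hA⟩
    induction l generalizing v with
    | nil => cases hl; exact Linked.refl _
    | cons e l ih =>
      obtain ⟨u, hu, hl⟩ := hl
      obtain ⟨s, hs⟩ := ends_eq_iff.1 hu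
      exact Relation.ReflTransGen.head ⟨e, hA e (by simp), s, hs⟩
        (ih hl fun e he => hA e (by simp [he]))

theorem isPath_append {l₁ l₂ : List G.E} {v w : G.V} (h : G.IsPath v (l₁ ++ l₂) w) :
    ∃ u, G.IsPath v l₁ u ∧ G.IsPath u l₂ w := by
  induction l₁ generalizing v with
  | nil => exact ⟨v, rfl, h⟩
  | cons e l ih =>
    obtain ⟨u, hu, hl⟩ := h
    obtain ⟨x, hx, hl⟩ := ih hl
    exact ⟨x, ⟨u, hu, hx⟩, hl⟩

/-- A path can be pruned: linked vertices are joined by a path without repeated edges. -/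
theorem Linked.exists_nodup {A : Set G.E} {v w : G.V} (h : Linked A v w) :
    ∃ l, G.IsPath v l w ∧ (∀ e ∈ l, e ∈ A) ∧ l.Nodup := by
  obtain ⟨l, hl, hA⟩ := linked_iff_isPath.1 h
  clear h
  induction l generalizing v with
  | nil => exact ⟨[], hl, hA, List.nodup_nil⟩
  | cons e l ih =>
    obtain ⟨u, hu, hl⟩ := hl
    obtain ⟨l', hl', hA', hnd⟩ := ih hl fun e he => hA e (by simp [he])
    have he : e ∈ A := hA e (by simp)
    by_cases hmem : e ∈ l'
    · -- `e` is used again later: skip the part of the path between the two passages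
      obtain ⟨l₁, l₂, rfl⟩ := List.append_of_mem hmem
      obtain ⟨x, -, y, hxy, hl₂⟩ := isPath_append hl'
      have hnd₂ := (List.nodup_append.1 hnd).2.1
      rcases Sym2.eq_iff.1 (hu.symm.trans hxy) with ⟨rfl, rfl⟩ | ⟨rfl, rfl⟩
      · exact ⟨e :: l₂, ⟨u, hu, hl₂⟩, fun f hf => hA' f (by simp at hf ⊢; tauto), hnd₂⟩
      · exact ⟨l₂, hl₂, fun f hf => hA' f (by simp; tauto), (List.nodup_cons.1 hnd₂).2⟩
    · exact ⟨e :: l', ⟨u, hu, hl'⟩, by simpa using ⟨he, hA'⟩, List.nodup_cons.2 ⟨hmem, hnd⟩⟩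

theorem Adjacent.refl (e : G.E) : G.Adjacent e e := ⟨true, true, rfl⟩

theorem Adjacent.symm {e f : G.E} (h : G.Adjacent e f) : G.Adjacent f e :=
  let ⟨s, t, h⟩ := h; ⟨t, s, h.symm⟩

end OGraph

/-! ### Replacement graphs -/

namespace SimpleIGS

open OGraph

variable {S : SimpleIGS.{u}} {n : ℕ}

/-- The vertex `[a, f]` of the graph following `S.graph n`: the vertex `a` of the copy of the
generator that replaces `f`. -/
def vertex (a : S.gen.V) (f : S.Edge n) : (S.graph (n + 1)).V := Quot.mk _ (a, f)

theorem endpt_succ (s : Bool) (e : S.Edge (n + 1)) :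
    (S.graph (n + 1)).endpt s e = vertex (S.gen.endpt s (digit e)) (parent e) := rfl

theorem exists_vertex (v : (S.graph (n + 1)).V) : ∃ a f, v = vertex (S := S) (n := n) a f := by
  obtain ⟨⟨a, f⟩, rfl⟩ := Quot.exists_rep v
  exact ⟨a, f, rfl⟩

theorem vertex_glue {f g : S.Edge n} {s t : Bool}
    (h : (S.graph n).endpt s f = (S.graph n).endpt t g) (i : S.I) :
    vertex (S.φ s i) f = vertex (S.φ t i) g :=
  Quot.sound ⟨s, t, i, h, rfl, rfl⟩

theorem φ_eq_iff {s t : Bool} {i j : S.I} : S.φ s i = S.φ t j ↔ s = t ∧ i = j := by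
  refine ⟨fun h => ?_, by rintro ⟨rfl, rfl⟩; rfl⟩
  have hst : s = t := by
    cases s <;> cases t <;> first | rfl | exact absurd h (S.disjoint_φ _ _) |
      exact absurd h.symm (S.disjoint_φ _ _)
  subst hst
  exact ⟨rfl, S.injective_φ _ h⟩

/-- The identifications generating `V_{n+1}` already form, with equality, an equivalence
relation. -/
theorem vertex_eq {a b : S.gen.V} {f g : S.Edge n} (h : vertex a f = vertex b g) :
    (a = b ∧ f = g) ∨ ∃ s t i, (S.graph n).endpt s f = (S.graph n).endpt t g ∧
      a = S.φ s i ∧ b = S.φ t i := by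
  have h' := Quot.eqvGen_exact h
  suffices H : ∀ p q : S.gen.V × S.Edge n, Relation.EqvGen (fun p q : S.gen.V × S.Edge n =>
      ∃ s t i, (S.graph n).endpt s p.2 = (S.graph n).endpt t q.2 ∧ p.1 = S.φ s i ∧
        q.1 = S.φ t i) p q → p = q ∨ ∃ s t i,
      (S.graph n).endpt s p.2 = (S.graph n).endpt t q.2 ∧ p.1 = S.φ s i ∧ q.1 = S.φ t i by
    rcases H _ _ h' with h | h
    · exact Or.inl ⟨congrArg Prod.fst h, congrArg Prod.snd h⟩
    · exact Or.inr h
  intro p q hpq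
  induction hpq with
  | rel _ _ h => exact Or.inr h
  | refl => exact Or.inl rfl
  | symm _ _ _ ih =>
    rcases ih with rfl | ⟨s, t, i, h, h₁, h₂⟩
    · exact Or.inl rfl
    · exact Or.inr ⟨t, s, i, h.symm, h₂, h₁⟩
  | trans _ _ _ _ _ ih₁ ih₂ =>
    rcases ih₁ with rfl | ⟨s, t, i, h, h₁, h₂⟩
    · exact ih₂
    rcases ih₂ with rfl | ⟨s', t', i', h', h₁', h₂'⟩
    · exact Or.inr ⟨s, t, i, h, h₁, h₂⟩
    obtain ⟨rfl, rfl⟩ := φ_eq_iff.1 (h₂.symm.trans h₁')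
    exact Or.inr ⟨s, t', i, h.trans h', h₁, h₂'⟩

/-- Adjacent edges have the same parent, or their digits sit at glued vertices `φ_a(i)`, `φ_b(i)`
and their parents share the corresponding endpoints. -/
theorem adjacent_succ {e f : S.Edge (n + 1)} (h : (S.graph (n + 1)).Adjacent e f) :
    parent e = parent f ∨ ∃ a b i s t, (S.graph n).endpt a (parent e) =
      (S.graph n).endpt b (parent f) ∧ S.gen.endpt s (digit e) = S.φ a i ∧
        S.gen.endpt t (digit f) = S.φ b i := by
  obtain ⟨s, t, h⟩ := h
  rcases vertex_eq h with ⟨-, h⟩ | ⟨a, b, i, h, h₁, h₂⟩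
  · exact Or.inl h
  · exact Or.inr ⟨a, b, i, s, t, h, h₁, h₂⟩

/-- Replacement graphs have no loops. -/
theorem endpt_injective (e : S.Edge n) {s t : Bool}
    (h : (S.graph n).endpt s e = (S.graph n).endpt t e) : s = t := by
  induction n generalizing s t with
  | zero =>
    have := S.loopless e
    cases s <;> cases t <;> first | rfl | exact absurd h this | exact absurd h.symm this
  | succ n ih =>
    have hl : S.gen.endpt s (digit e) = S.gen.endpt t (digit e) := by
      rcases vertex_eq h with ⟨h, -⟩ | ⟨a, b, i, h, h₁, h₂⟩
      · exact h
      · obtain rfl := ih _ h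
        exact h₁.trans h₂.symm
    have := S.loopless (digit e)
    cases s <;> cases t <;> first | rfl | exact absurd hl this | exact absurd hl.symm this

theorem finite_edge (n : ℕ) : Finite (S.Edge n) := by
  induction n with
  | zero => exact Finite.of_fintype S.gen.E
  | succ n ih => exact (inferInstance : Finite (S.gen.E × S.Edge n))

/-! ### Descendants and covers -/

theorem Below.le {k : ℕ} {e : S.Edge k} {g : S.Edge n} (h : Below e n g) : k ≤ n := by
  induction h with
  | refl => exact le_rfl
  | step _ _ ih => omega

theorem below_succ {k : ℕ} {e : S.Edge k} {g : S.Edge (n + 1)} (h : Below e (n + 1) g) :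
    (⟨k, e⟩ : Σ k, S.Edge k) = ⟨n + 1, g⟩ ∨ Below e n (parent g) := by
  cases h with
  | refl => exact Or.inl rfl
  | step _ h => exact Or.inr h

/-- The edges of level `n` in the subgraphs that replace the edges in `Ω`. -/
def cover (Ω : Set (Σ k, S.Edge k)) (n : ℕ) : Set (S.Edge n) := {g | ∃ a ∈ Ω, Below a.2 n g}

theorem cover_mono {Ω Ω' : Set (Σ k, S.Edge k)} (h : Ω ⊆ Ω') (n : ℕ) : cover Ω n ⊆ cover Ω' n :=
  fun _ ⟨a, ha, hb⟩ => ⟨a, h ha, hb⟩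

theorem mem_cover_self {Ω : Set (Σ k, S.Edge k)} {e : S.Edge n} (h : ⟨n, e⟩ ∈ Ω) :
    e ∈ cover Ω n := ⟨_, h, Below.refl⟩

theorem mem_cover_succ {Ω : Set (Σ k, S.Edge k)} {e : S.Edge (n + 1)}
    (h : parent e ∈ cover Ω n) : e ∈ cover Ω (n + 1) :=
  let ⟨a, ha, hb⟩ := h; ⟨a, ha, Below.step _ hb⟩

/-! ### Refining paths -/

theorem linked_vertex {A : Set (S.Edge n)} {p : S.Edge n} (hp : p ∈ A) (a b : S.gen.V) :
    Linked (G := S.graph (n + 1)) (parent ⁻¹' A) (vertex a p) (vertex b p) := by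
  obtain ⟨l, hl⟩ := S.connected a b
  have h : Linked (G := S.gen) Set.univ a b := linked_iff_isPath.2 ⟨l, hl, fun _ _ => trivial⟩
  refine Relation.ReflTransGen.lift (fun a => vertex a p) ?_ a b h
  rintro _ _ ⟨e, -, s, rfl, rfl⟩
  exact ⟨child e p, hp, s, rfl, rfl⟩

/-- A path through edges of `A` refines to a path through children of edges of `A`, with any
prescribed starting and end points in the copies replacing its first and last edges. -/
theorem linked_refine {A : Set (S.Edge n)} {p q : S.Edge n} (hp : p ∈ A) (hq : q ∈ A)
    {s t : Bool} (h : Linked A ((S.graph n).endpt s p) ((S.graph n).endpt t q))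
    (a b : S.gen.V) :
    Linked (G := S.graph (n + 1)) (parent ⁻¹' A) (vertex a p) (vertex b q) := by
  obtain ⟨i⟩ := S.nonempty_I
  suffices H : ∀ v, Linked A v ((S.graph n).endpt t q) → ∀ s p, p ∈ A →
      (S.graph n).endpt s p = v → ∀ a,
      Linked (G := S.graph (n + 1)) (parent ⁻¹' A) (vertex a p) (vertex b q) from
    H _ h s p hp rfl a
  intro v hv
  induction hv using Relation.ReflTransGen.head_induction_on with
  | refl =>
    intro s p hp h a
    have h₁ := linked_vertex hp a (S.φ s i)
    rw [vertex_glue h i] at h₁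
    exact h₁.trans (linked_vertex hq _ b)
  | head hstep _ ih =>
    intro s p hp h a
    obtain ⟨e, he, s', h₁, h₂⟩ := hstep
    have h₃ := linked_vertex hp a (S.φ s i)
    rw [vertex_glue (h.trans h₁.symm) i] at h₃
    exact h₃.trans (ih _ e he h₂ _)

theorem linked_univ (n : ℕ) (v w : (S.graph n).V) : Linked Set.univ v w := by
  cases n with
  | zero =>
    obtain ⟨l, hl⟩ := S.connected v w
    exact linked_iff_isPath.2 ⟨l, hl, fun _ _ => trivial⟩
  | succ n =>
    have ih := linked_univ n
    obtain ⟨a, p, rfl⟩ := exists_vertex v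
    obtain ⟨b, q, rfl⟩ := exists_vertex w
    exact (linked_refine (s := true) (t := true) (Set.mem_univ p) (Set.mem_univ q) (ih _ _) a b).mono
      (Set.subset_univ _)

/-! ### Coarsening paths -/

/-- The digits `c` for which the child `(c, q)` of `q` lies in the cover of `Ω`. -/
def coveredDigits (Ω : Set (Σ k, S.Edge k)) (q : S.Edge n) : Set S.gen.E :=
  {c | child c q ∈ cover Ω (n + 1)}

/-- If every edge of level `n` that the cover of `Ω` crosses from side to side belongs to `A`, then
a path in the cover of `Ω` at level `n + 1` projects to a path in `A`. -/
theorem linked_coarsen {Ω : Set (Σ k, S.Edge k)} {A : Set (S.Edge n)}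
    (hA : ∀ q s i j, Linked (G := S.gen) (coveredDigits Ω q) (S.φ s i) (S.φ (!s) j) → q ∈ A)
    {a b : S.gen.V} {p q : S.Edge n}
    (h : Linked (G := S.graph (n + 1)) (cover Ω (n + 1)) (vertex a p) (vertex b q)) :
    ∃ s t, Linked A ((S.graph n).endpt s p) ((S.graph n).endpt t q) := by
  -- the vertices of level `n` reached from an endpoint of `p`
  let R : Set (S.graph n).V := {v | ∃ s, Linked A ((S.graph n).endpt s p) v}
  -- the vertices reached at level `n + 1`, together with the side through which the copy
  -- replacing `q` has been entered
  let P : S.gen.V × S.Edge n → Prop := fun x => x.2 = p ∨ ∃ t i, (S.graph n).endpt t x.2 ∈ R ∧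
    Linked (G := S.gen) (coveredDigits Ω x.2) (S.φ t i) x.1
  have hstart : ∀ s, (S.graph n).endpt s p ∈ R := fun s => ⟨s, Linked.refl _⟩
  have hexit : ∀ s i q, P (S.φ s i, q) → (S.graph n).endpt s q ∈ R := by
    rintro s i q (h | ⟨t, j, ⟨s₀, h₀⟩, h⟩)
    · obtain rfl : q = p := h
      exact hstart s
    · by_cases hst : s = t
      · subst hst; exact ⟨s₀, h₀⟩
      · obtain rfl : s = !t := by cases s <;> cases t <;> simp_all
        exact ⟨s₀, h₀.trans (linked_endpt (hA q t j i h) _ _)⟩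
  have hresp : ∀ x y : S.gen.V × S.Edge n, (∃ s t i,
      (S.graph n).endpt s x.2 = (S.graph n).endpt t y.2 ∧ x.1 = S.φ s i ∧ y.1 = S.φ t i) →
      P x → P y := by
    rintro ⟨_, q⟩ ⟨_, q'⟩ ⟨s, t, i, h, rfl, rfl⟩ hx
    have h' : (S.graph n).endpt t q' ∈ R := by
      have := hexit s i q hx
      rwa [show (S.graph n).endpt s q = (S.graph n).endpt t q' from h] at this
    exact Or.inr ⟨t, i, h', Linked.refl _⟩
  let U : (S.graph (n + 1)).V → Prop := Quot.lift P fun x y hxy => propext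
    ⟨hresp x y hxy, hresp y x (let ⟨s, t, i, h, h₁, h₂⟩ := hxy; ⟨t, s, i, h.symm, h₂, h₁⟩)⟩
  have hU : ∀ v, Linked (G := S.graph (n + 1)) (cover Ω (n + 1)) (vertex a p) v → U v := by
    intro v hv
    induction hv with
    | refl => exact Or.inl rfl
    | tail _ hstep ih =>
      obtain ⟨e, he, s, rfl, rfl⟩ := hstep
      rcases ih with h | ⟨t, i, hR, hl⟩
      · exact Or.inl h
      · exact Or.inr ⟨t, i, hR, hl.trans (linked_endpt (e := digit e) he _ _)⟩
  rcases hU _ h with h | ⟨t, i, ⟨s, hs⟩, -⟩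
  · obtain rfl : q = p := h
    exact ⟨true, true, Linked.refl _⟩
  · exact ⟨s, t, hs⟩

end SimpleIGS

/-! ### Weights and the distances at finite levels -/

namespace SimpleIGS

open OGraph

variable {S : SimpleIGS.{u}} {n : ℕ} {ρ : S.gen.E → ℝ}

theorem cascade_succ (ρ : S.gen.E → ℝ) (e : S.Edge (n + 1)) :
    S.cascade ρ (n + 1) e = S.cascade ρ n (parent e) * ρ (digit e) := rfl

theorem cascade_pos (hρ : ∀ e, 0 < ρ e) (e : S.Edge n) : 0 < S.cascade ρ n e := by
  induction n with
  | zero => exact hρ e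
  | succ n ih => exact mul_pos (ih _) (hρ _)

theorem cascade_le_of_below (hρ : ∀ e, ρ e ∈ Set.Ioo (0 : ℝ) 1) {k : ℕ} {e : S.Edge k}
    {g : S.Edge n} (h : Below e n g) : S.cascade ρ n g ≤ S.cascade ρ k e := by
  induction h with
  | refl => exact le_rfl
  | step g _ ih =>
    rw [cascade_succ]
    exact (mul_le_of_le_one_right (cascade_pos (fun e => (hρ e).1) _).le (hρ _).2.le).trans ih

/-- The mass of a finite set of edges of various levels. -/
def mass (ρ : S.gen.E → ℝ) (Ω : Finset (Σ k, S.Edge k)) : ℝ := ∑ a ∈ Ω, S.cascade ρ a.1 a.2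

theorem mass_nonneg (hρ : ∀ e, 0 < ρ e) (Ω : Finset (Σ k, S.Edge k)) : 0 ≤ mass ρ Ω :=
  Finset.sum_nonneg fun _ _ => (cascade_pos hρ _).le

theorem mass_map (ρ : S.gen.E → ℝ) (A : Finset (S.Edge n)) :
    mass ρ (A.map (Function.Embedding.sigmaMk n)) = ∑ e ∈ A, S.cascade ρ n e :=
  Finset.sum_map _ _ _

theorem mass_insert_le [DecidableEq (Σ k, S.Edge k)] (hρ : ∀ e, 0 < ρ e)
    (Ω : Finset (Σ k, S.Edge k)) (e : S.Edge n) :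
    mass ρ (insert ⟨n, e⟩ Ω) ≤ S.cascade ρ n e + mass ρ Ω := by
  by_cases h : (⟨n, e⟩ : Σ k, S.Edge k) ∈ Ω
  · rw [Finset.insert_eq_of_mem h]
    exact le_add_of_nonneg_left (cascade_pos hρ _).le
  · exact (Finset.sum_insert h).le

theorem mass_union_le [DecidableEq (Σ k, S.Edge k)] (hρ : ∀ e, 0 < ρ e)
    (Ω Ω' : Finset (Σ k, S.Edge k)) : mass ρ (Ω ∪ Ω') ≤ mass ρ Ω + mass ρ Ω' := by
  have h := Finset.sum_union_inter (s₁ := Ω) (s₂ := Ω') (f := fun a => S.cascade ρ a.1 a.2)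
  have h' := mass_nonneg hρ (Ω ∩ Ω')
  unfold mass at *
  linarith

theorem mem_chains_iff {v w : (S.graph n).V} {Ω : Finset (Σ k, S.Edge k)} :
    Ω ∈ S.chains n v w ↔ (∀ a ∈ Ω, a.1 ≤ n) ∧ Linked (cover (Ω : Set (Σ k, S.Edge k)) n) v w := by
  rw [linked_iff_isPath]; rfl

theorem vertexDist_lt_iff (hρ : ∀ e, 0 < ρ e) {v w : (S.graph n).V} {r : ℝ} :
    S.vertexDist ρ n v w < r ↔ ∃ Ω : Finset (Σ k, S.Edge k), (∀ a ∈ Ω, a.1 ≤ n) ∧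
      Linked (cover (Ω : Set (Σ k, S.Edge k)) n) v w ∧ mass ρ Ω < r := by
  unfold vertexDist
  split_ifs with hvw
  · subst hvw
    constructor
    · intro hr
      exact ⟨∅, by simp, Linked.refl _, by simpa [mass] using hr⟩
    · rintro ⟨Ω, -, -, hΩ⟩
      exact (mass_nonneg hρ Ω).trans_lt hΩ
  · constructor
    · intro h
      have hne : ((mass ρ) '' S.chains n v w).Nonempty := by
        have := finite_edge (S := S) n
        have := Fintype.ofFinite (S.Edge n)
        refine ⟨_, (Finset.univ : Finset (S.Edge n)).map (Function.Embedding.sigmaMk n), ?_, rfl⟩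
        exact mem_chains_iff.2 ⟨by simp, (linked_univ n v w).mono fun e _ =>
          mem_cover_self (by simp)⟩
      obtain ⟨_, ⟨Ω, hΩ, rfl⟩, hr⟩ := exists_lt_of_csInf_lt hne h
      exact ⟨Ω, (mem_chains_iff.1 hΩ).1, (mem_chains_iff.1 hΩ).2, hr⟩
    · rintro ⟨Ω, h₁, h₂, h₃⟩
      have hbdd : BddBelow (mass ρ '' S.chains n v w) := ?_
      · exact (csInf_le hbdd ⟨Ω, mem_chains_iff.2 ⟨h₁, h₂⟩, rfl⟩).trans_lt h₃
      refine ⟨0, ?_⟩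
      rintro _ ⟨Ω', -, rfl⟩
      exact mass_nonneg hρ Ω'

theorem edgeDist_lt_iff (hρ : ∀ e, 0 < ρ e) {e f : S.Edge n} {r : ℝ} :
    S.edgeDist ρ n e f < r ↔ ∃ Ω : Finset (Σ k, S.Edge k), (∀ a ∈ Ω, a.1 ≤ n) ∧ (∃ s t,
      Linked (cover (Ω : Set (Σ k, S.Edge k)) n) ((S.graph n).endpt s e)
        ((S.graph n).endpt t f)) ∧ mass ρ Ω < r := by
  unfold edgeDist
  constructor
  · intro h
    obtain ⟨p, hp⟩ := exists_lt_of_ciInf_lt h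
    obtain ⟨Ω, h₁, h₂, h₃⟩ := (vertexDist_lt_iff hρ).1 hp
    exact ⟨Ω, h₁, ⟨_, _, h₂⟩, h₃⟩
  · rintro ⟨Ω, h₁, ⟨s, t, h₂⟩, h₃⟩
    exact (ciInf_le (Set.finite_range _).bddBelow (s, t)).trans_lt
      ((vertexDist_lt_iff hρ).2 ⟨Ω, h₁, h₂, h₃⟩)

theorem edgeDist_nonneg (hρ : ∀ e, 0 < ρ e) (e f : S.Edge n) : 0 ≤ S.edgeDist ρ n e f := by
  by_contra! h
  obtain ⟨Ω, -, -, h⟩ := (edgeDist_lt_iff hρ).1 h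
  exact (mass_nonneg hρ Ω).not_gt h

theorem edgeDist_comm (hρ : ∀ e, 0 < ρ e) (e f : S.Edge n) :
    S.edgeDist ρ n e f = S.edgeDist ρ n f e := by
  refine eq_of_forall_gt_iff fun r => ?_
  rw [edgeDist_lt_iff hρ, edgeDist_lt_iff hρ]
  constructor <;>
    exact fun ⟨Ω, h₁, ⟨s, t, h₂⟩, h₃⟩ => ⟨Ω, h₁, ⟨t, s, h₂.symm⟩, h₃⟩

theorem edgeDist_eq_zero (hρ : ∀ e, 0 < ρ e) {e f : S.Edge n} (h : (S.graph n).Adjacent e f) :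
    S.edgeDist ρ n e f = 0 := by
  refine le_antisymm (le_of_forall_gt fun r hr => ?_) (edgeDist_nonneg hρ e f)
  obtain ⟨s, t, h⟩ := h
  exact (edgeDist_lt_iff hρ).2 ⟨∅, by simp, ⟨s, t, h ▸ Linked.refl _⟩, by simpa [mass] using hr⟩

theorem edgeDist_triangle (hρ : ∀ e, 0 < ρ e) (e f g : S.Edge n) :
    S.edgeDist ρ n e g ≤ S.edgeDist ρ n e f + S.cascade ρ n f + S.edgeDist ρ n f g := by
  classical
  refine le_of_forall_pos_lt_add fun ε hε => ?_
  obtain ⟨Ω, h₁, ⟨s, t, h₂⟩, h₃⟩ := (edgeDist_lt_iff hρ (e := e) (f := f)).1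
    (lt_add_of_pos_right _ (half_pos hε))
  obtain ⟨Ω', h₁', ⟨s', t', h₂'⟩, h₃'⟩ := (edgeDist_lt_iff hρ (e := f) (f := g)).1
    (lt_add_of_pos_right _ (half_pos hε))
  refine (edgeDist_lt_iff hρ).2 ⟨insert ⟨n, f⟩ (Ω ∪ Ω'), ?_, ⟨s, t', ?_⟩, ?_⟩
  · intro a ha
    rcases Finset.mem_insert.1 ha with rfl | ha
    · exact le_rfl
    · exact (Finset.mem_union.1 ha).elim (h₁ a) (h₁' a)
  · refine (h₂.mono (cover_mono ?_ n)).trans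
      ((linked_endpt (mem_cover_self ?_) t s').trans (h₂'.mono (cover_mono ?_ n)))
    · intro a ha; simp at ha ⊢; tauto
    · simp
    · intro a ha; simp at ha ⊢; tauto
  · have := mass_insert_le hρ (Ω ∪ Ω') f
    have := mass_union_le hρ Ω Ω'
    linarith

theorem edgeDist_zero_le (hρ : ∀ e, 0 < ρ e) (e f : S.Edge 0) :
    S.edgeDist ρ 0 e f ≤ ∑ c, ρ c := by
  have hmass : mass ρ ((Finset.univ : Finset S.gen.E).map
      (Function.Embedding.sigmaMk (β := S.Edge) 0)) = ∑ c, ρ c := mass_map (n := 0) ρ _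
  refine le_of_forall_gt fun r hr => (edgeDist_lt_iff hρ).2 ⟨_, ?_,
    ⟨true, true, (linked_univ 0 _ _).mono fun e _ => mem_cover_self ?_⟩, hmass.trans_lt hr⟩
  · intro a ha
    obtain ⟨c, -, rfl⟩ := Finset.mem_map.1 ha
    exact le_rfl
  · exact Finset.mem_coe.2 (Finset.mem_map.2 ⟨e, Finset.mem_univ (α := S.gen.E) e, rfl⟩)

/-- The distance can grow from one level to the later ones by no more than the weights of the two
edges. -/
theorem edgeDist_le_add (hρ : ∀ e, 0 < ρ e) (x y : S.Symbol) {m : ℕ} (hnm : n ≤ m) :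
    S.edgeDist ρ m (x.1 m) (y.1 m) ≤
      S.edgeDist ρ n (x.1 n) (y.1 n) + S.cascade ρ n (x.1 n) + S.cascade ρ n (y.1 n) := by
  classical
  refine le_of_forall_pos_lt_add fun ε hε => ?_
  obtain ⟨Ω, h₁, ⟨s, t, h₂⟩, h₃⟩ := (edgeDist_lt_iff hρ (e := x.1 n) (f := y.1 n)).1
    (lt_add_of_pos_right _ hε)
  obtain ⟨Ω', hΩ'⟩ : ∃ Ω', Ω' = insert ⟨n, x.1 n⟩ (insert ⟨n, y.1 n⟩ Ω) := ⟨_, rfl⟩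
  have hx : ∀ m, n ≤ m → x.1 m ∈ cover (Ω' : Set (Σ k, S.Edge k)) m := by
    intro m hm
    induction m, hm using Nat.le_induction with
    | base => exact mem_cover_self (by simp [hΩ'])
    | succ m _ ih => exact mem_cover_succ (by rwa [x.2])
  have hy : ∀ m, n ≤ m → y.1 m ∈ cover (Ω' : Set (Σ k, S.Edge k)) m := by
    intro m hm
    induction m, hm using Nat.le_induction with
    | base => exact mem_cover_self (by simp [hΩ'])
    | succ m _ ih => exact mem_cover_succ (by rwa [y.2])
  have hlink : Linked (cover (Ω' : Set (Σ k, S.Edge k)) m) ((S.graph m).endpt s (x.1 m))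
      ((S.graph m).endpt t (y.1 m)) := by
    induction m, hnm using Nat.le_induction with
    | base => exact h₂.mono (cover_mono (by intro a ha; simp [hΩ'] at ha ⊢; tauto) n)
    | succ m hm ih =>
      have := linked_refine (hx m hm) (hy m hm) ih
        (S.gen.endpt s (digit (x.1 (m + 1)))) (S.gen.endpt t (digit (y.1 (m + 1))))
      rw [endpt_succ, endpt_succ, x.2, y.2]
      exact this.mono fun e he => mem_cover_succ he
  refine (edgeDist_lt_iff hρ).2 ⟨Ω', ?_, ⟨s, t, hlink⟩, ?_⟩
  · intro a ha
    rw [hΩ', Finset.mem_insert, Finset.mem_insert] at ha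
    rcases ha with rfl | rfl | ha
    · exact hnm
    · exact hnm
    · exact (h₁ a ha).trans hnm
  · have := mass_insert_le hρ (insert ⟨n, y.1 n⟩ Ω) (x.1 n)
    have := mass_insert_le hρ Ω (y.1 n)
    rw [hΩ']
    linarith

/-- Admissibility for sets of edges in place of paths. A path may count an edge twice, so the path is
pruned before its length is compared with the sum over the set. -/
theorem one_le_sum_of_linked (hρ : ∀ e, 0 < ρ e) (hadm : S.Admissible ρ) {A : Finset S.gen.E}
    {s : Bool} {i j : S.I} (h : Linked (G := S.gen) (A : Set S.gen.E) (S.φ s i) (S.φ (!s) j)) :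
    1 ≤ ∑ c ∈ A, ρ c := by
  classical
  obtain ⟨i', j', h'⟩ : ∃ i' j', Linked (G := S.gen) (A : Set S.gen.E) (S.φ false i')
      (S.φ true j') := by
    cases s
    · exact ⟨i, j, h⟩
    · exact ⟨j, i, h.symm⟩
  obtain ⟨l, hl, hlA, hnd⟩ := h'.exists_nodup
  calc 1 ≤ (l.map ρ).sum := hadm _ ⟨i', rfl⟩ _ ⟨j', rfl⟩ l hl
    _ = ∑ c ∈ l.toFinset, ρ c := (List.sum_toFinset ρ hnd).symm
    _ ≤ ∑ c ∈ A, ρ c := Finset.sum_le_sum_of_subset_of_nonneg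
        (fun c hc => by simpa using hlA c (List.mem_toFinset.1 hc)) fun c _ _ => (hρ c).le

/-- Passing to the parents does not increase distances: by admissibility, the children of `q` used
by a path crossing `q` can be replaced by `q` at no extra cost. -/
theorem edgeDist_parent_le (hρ : ∀ e, 0 < ρ e) (hadm : S.Admissible ρ) (e f : S.Edge (n + 1)) :
    S.edgeDist ρ n (parent e) (parent f) ≤ S.edgeDist ρ (n + 1) e f := by
  classical
  have := finite_edge (S := S) n
  have := Fintype.ofFinite (S.Edge n)
  refine le_of_forall_gt fun r hr => ?_
  obtain ⟨Ω, h₁, ⟨s, t, h₂⟩, h₃⟩ := (edgeDist_lt_iff hρ).1 hr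
  -- `D q` is the set of children of `q` that belong to `Ω`
  let D : S.Edge n → Finset S.gen.E := fun q =>
    Finset.univ.filter fun c => (⟨n + 1, child c q⟩ : Σ k, S.Edge k) ∈ Ω
  let Q : Finset (S.Edge n) := Finset.univ.filter fun q => 1 ≤ ∑ c ∈ D q, ρ c
  let up : S.Edge n ↪ Σ k, S.Edge k := Function.Embedding.sigmaMk n
  let Ω₀ := Ω.filter fun a => a.1 ≤ n
  let Ω₁ := Ω.filter fun a => ¬ a.1 ≤ n
  have hsplit : mass ρ Ω₀ + mass ρ Ω₁ = mass ρ Ω := Finset.sum_filter_add_sum_filter_not _ _ _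
  have hQ : mass ρ (Q.map up) ≤ mass ρ Ω₁ := by
    let dn : (Σ _ : S.Edge n, S.gen.E) ↪ Σ k, S.Edge k :=
      ⟨fun p => ⟨n + 1, child p.2 p.1⟩, fun a b h => by
        have h' : child a.2 a.1 = child b.2 b.1 := by simpa using h
        exact Sigma.ext (congrArg parent h') (heq_of_eq (congrArg digit h'))⟩
    calc mass ρ (Q.map up) = ∑ q ∈ Q, S.cascade ρ n q := mass_map ρ Q
      _ ≤ ∑ q ∈ Q, ∑ c ∈ D q, S.cascade ρ (n + 1) (child c q) := by
          refine Finset.sum_le_sum fun q hq => ?_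
          have h := (Finset.mem_filter.1 hq).2
          calc S.cascade ρ n q ≤ S.cascade ρ n q * ∑ c ∈ D q, ρ c :=
                le_mul_of_one_le_right (cascade_pos hρ q).le h
            _ = _ := Finset.mul_sum _ _ _
      _ = mass ρ ((Q.sigma D).map dn) := by
          rw [mass, Finset.sum_map, Finset.sum_sigma]; rfl
      _ ≤ mass ρ Ω₁ := by
          refine Finset.sum_le_sum_of_subset_of_nonneg ?_ fun _ _ _ => (cascade_pos hρ _).le
          intro a ha
          obtain ⟨⟨q, c⟩, hqc, rfl⟩ := Finset.mem_map.1 ha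
          have hc := (Finset.mem_filter.1 (Finset.mem_sigma.1 hqc).2).2
          exact Finset.mem_filter.2 ⟨hc, (Nat.lt_succ_self n).not_ge⟩
  refine (edgeDist_lt_iff hρ).2 ⟨Ω₀ ∪ Q.map up, ?_, ?_, ?_⟩
  · intro a ha
    rcases Finset.mem_union.1 ha with ha | ha
    · exact (Finset.mem_filter.1 ha).2
    · obtain ⟨q, -, rfl⟩ := Finset.mem_map.1 ha
      exact le_rfl
  · refine linked_coarsen (Ω := (Ω : Set (Σ k, S.Edge k))) ?_ h₂
    intro q s i j hq
    by_cases hcov : ∃ a ∈ Ω₀, Below a.2 n q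
    · obtain ⟨a, ha, hb⟩ := hcov
      exact ⟨a, by simp only [Finset.coe_union]; exact Or.inl ha, hb⟩
    · refine mem_cover_self ?_
      have hD : Linked (G := S.gen) (D q : Set S.gen.E) (S.φ s i) (S.φ (!s) j) := by
        refine hq.mono ?_
        rintro c ⟨a, ha, hb⟩
        rcases below_succ hb with h | h
        · exact Finset.mem_filter.2 ⟨Finset.mem_univ _, by rw [← h]; exact ha⟩
        · exact absurd ⟨a, Finset.mem_filter.2 ⟨ha, h.le⟩, h⟩ hcov
      rw [Finset.mem_coe, Finset.mem_union]
      exact Or.inr (Finset.mem_map.2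
        ⟨q, Finset.mem_filter.2 ⟨Finset.mem_univ _, one_le_sum_of_linked hρ hadm hD⟩, rfl⟩)
  · have := mass_union_le hρ Ω₀ (Q.map up)
    linarith

/-! ### Adjacent edges -/

/-- Symmetry and doubling: edges at glued vertices `φ_±(i)` have the same weight. -/
theorem weight_eq_of_glued (hD : S.Doubling) {η : S.Symmetry} (hη : ∀ e, ρ (η.onE e) = ρ e)
    {c c' : S.gen.E} {a b s t : Bool} {i : S.I} (hc : S.gen.endpt s c = S.φ a i)
    (hc' : S.gen.endpt t c' = S.φ b i) : ρ c = ρ c' := by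
  have huniq : ∀ (a : Bool) (i : S.I) (c c' : S.gen.E), (∃ s, S.gen.endpt s c = S.φ a i) →
      (∃ s, S.gen.endpt s c' = S.φ a i) → c = c' := by
    intro a i c c' hc hc'
    obtain ⟨x, hx⟩ := Set.ncard_eq_one.1 (hD a _ ⟨i, rfl⟩)
    have h₁ : c ∈ ({x} : Set S.gen.E) := hx ▸ hc
    have h₂ : c' ∈ ({x} : Set S.gen.E) := hx ▸ hc'
    rw [Set.mem_singleton_iff.1 h₁, Set.mem_singleton_iff.1 h₂]
  by_cases hab : b = a
  · subst hab
    rw [huniq _ i c c' ⟨s, hc⟩ ⟨t, hc'⟩]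
  · obtain rfl : b = !a := by cases a <;> cases b <;> simp_all
    have h : ∃ s, S.gen.endpt s (η.onE c) = S.φ (!a) i := by
      have hmem : S.φ a i ∈ S.gen.ends c := by
        rw [← hc]; cases s <;> simp [OGraph.ends]
      have : S.φ (!a) i ∈ S.gen.ends (η.onE c) := by
        rw [η.ends_onE, ← η.swap]
        exact Sym2.mem_map.2 ⟨_, hmem, rfl⟩
      rcases Sym2.mem_iff.1 this with h | h
      · exact ⟨_, h.symm⟩
      · exact ⟨_, h.symm⟩
    rw [← hη c, huniq _ i (η.onE c) c' h ⟨t, hc'⟩]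

end SimpleIGS

namespace SimpleIGS

open OGraph

variable {S : SimpleIGS.{u}} {n : ℕ} {ρ : S.gen.E → ℝ} {η : S.Symmetry} {c : ℝ}

/-- Adjacent edges have comparable weights: after the first digit in which they differ, the
digits of two adjacent edges sit at glued vertices, so they have the same weights. -/
theorem cascade_comparable (hD : S.Doubling) (hρ : IsSymmetricAdmissible η ρ) (hc : 0 ≤ c)
    (hcρ : ∀ e, c ≤ ρ e) {e f : S.Edge n} (h : (S.graph n).Adjacent e f) :
    c * S.cascade ρ n e ≤ S.cascade ρ n f := by
  induction n with
  | zero => exact (mul_le_of_le_one_right hc (hρ.mem_Ioo _).2.le).trans (hcρ _)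
  | succ n ih =>
    have hpos := fun e : S.Edge n => (cascade_pos (fun e => (hρ.mem_Ioo e).1) e).le
    rw [cascade_succ, cascade_succ]
    rcases adjacent_succ h with h' | ⟨a, b, i, s, t, h', h₁, h₂⟩
    · rw [h', mul_left_comm]
      exact mul_le_mul_of_nonneg_left
        ((mul_le_of_le_one_right hc (hρ.mem_Ioo _).2.le).trans (hcρ _)) (hpos _)
    · rw [weight_eq_of_glued hD hρ.symmetric h₁ h₂, ← mul_assoc]
      exact mul_le_mul_of_nonneg_right (ih ⟨a, b, h'⟩) (hρ.mem_Ioo _).1.le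

/-- Non-adjacent edges are far apart relative to their weights: the first edge of a path joining
them is adjacent to the first of them. -/
theorem le_edgeDist_of_not_adjacent (hD : S.Doubling) (hρ : IsSymmetricAdmissible η ρ)
    (hc : 0 ≤ c) (hcρ : ∀ e, c ≤ ρ e) {e f : S.Edge n} (h : ¬ (S.graph n).Adjacent e f) :
    c * S.cascade ρ n e ≤ S.edgeDist ρ n e f := by
  have hpos : ∀ e, 0 < ρ e := fun e => (hρ.mem_Ioo e).1
  refine le_of_forall_gt fun r hr => ?_
  obtain ⟨Ω, -, ⟨s, t, h₂⟩, h₃⟩ := (edgeDist_lt_iff hpos).1 hr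
  rcases Relation.ReflTransGen.cases_head h₂ with h' | ⟨v, ⟨g, ⟨a, ha, hb⟩, s', hg, -⟩, -⟩
  · exact absurd ⟨s, t, h'⟩ h
  · calc c * S.cascade ρ n e ≤ S.cascade ρ n g :=
          cascade_comparable hD hρ hc hcρ ⟨s, s', hg.symm⟩
      _ ≤ S.cascade ρ a.1 a.2 := cascade_le_of_below hρ.mem_Ioo hb
      _ ≤ mass ρ Ω := Finset.single_le_sum (f := fun a => S.cascade ρ a.1 a.2)
          (fun _ _ => (cascade_pos hpos _).le) ha
      _ < r := h₃

/-- Degrees do not grow: the edges at a vertex inject into those of the generator. -/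
theorem exists_injOn_edges_at (hD : S.Doubling) (v : (S.graph n).V) :
    ∃ F : S.Edge n → S.gen.E, Set.InjOn F {e | ∃ s, (S.graph n).endpt s e = v} := by
  induction n with
  | zero => exact ⟨fun e => e, fun _ _ _ _ h => h⟩
  | succ n ih =>
    obtain ⟨b, q, rfl⟩ := exists_vertex v
    by_cases hb : ∃ a i, b = S.φ a i
    · obtain ⟨a, i, rfl⟩ := hb
      obtain ⟨F, hF⟩ := ih ((S.graph n).endpt a q)
      have key : ∀ e : S.Edge (n + 1), (∃ s, (S.graph (n + 1)).endpt s e = vertex (S.φ a i) q) →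
          ∃ s t, S.gen.endpt s (digit e) = S.φ t i ∧
            (S.graph n).endpt t (parent e) = (S.graph n).endpt a q := by
        rintro e ⟨s, hs⟩
        rcases vertex_eq hs with ⟨h₁, h₂⟩ | ⟨t, a', i', h, h₁, h₂⟩
        · exact ⟨s, a, h₁, congrArg _ h₂⟩
        · obtain ⟨rfl, rfl⟩ := φ_eq_iff.1 h₂
          exact ⟨s, t, h₁, h⟩
      refine ⟨fun e => F (parent e), fun e he f hf hef => ?_⟩
      obtain ⟨s, t, h₁, h₂⟩ := key e he
      obtain ⟨s', t', h₁', h₂'⟩ := key f hf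
      have hp : parent e = parent f := hF ⟨t, h₂⟩ ⟨t', h₂'⟩ hef
      have ht : t = t' := endpt_injective (parent e) (h₂.trans (by rw [hp, h₂']))
      subst ht
      obtain ⟨x, hx⟩ := Set.ncard_eq_one.1 (hD t _ ⟨i, rfl⟩)
      have m₁ : digit e ∈ ({x} : Set S.gen.E) := hx ▸ ⟨s, h₁⟩
      have m₂ : digit f ∈ ({x} : Set S.gen.E) := hx ▸ ⟨s', h₁'⟩
      have hd : digit e = digit f :=
        (Set.mem_singleton_iff.1 m₁).trans (Set.mem_singleton_iff.1 m₂).symm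
      exact Prod.ext hd hp
    · refine ⟨digit, fun e he f hf hef => ?_⟩
      have key : ∀ e : S.Edge (n + 1), (∃ s, (S.graph (n + 1)).endpt s e = vertex b q) →
          parent e = q := by
        rintro e ⟨s, hs⟩
        rcases vertex_eq hs with ⟨-, h₂⟩ | ⟨t, a', i', -, -, h₂⟩
        · exact h₂
        · exact absurd ⟨a', i', h₂⟩ hb
      exact Prod.ext hef ((key e he).trans (key f hf).symm)

theorem exists_finset_adjacent (hD : S.Doubling) (e : S.Edge n) :
    ∃ T : Finset (S.Edge n), (∀ f, f ∈ T ↔ (S.graph n).Adjacent e f) ∧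
      T.card ≤ 2 * Fintype.card S.gen.E := by
  classical
  have := finite_edge (S := S) n
  have := Fintype.ofFinite (S.Edge n)
  let A : Bool → Finset (S.Edge n) := fun s =>
    Finset.univ.filter fun f => ∃ t, (S.graph n).endpt t f = (S.graph n).endpt s e
  have hA : ∀ s, (A s).card ≤ Fintype.card S.gen.E := by
    intro s
    obtain ⟨F, hF⟩ := exists_injOn_edges_at hD ((S.graph n).endpt s e)
    refine Finset.card_le_card_of_injOn F (fun _ _ => Finset.mem_univ _) ?_
    exact hF.mono fun f hf => (Finset.mem_filter.1 hf).2
  refine ⟨A false ∪ A true, fun f => ?_, ?_⟩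
  · simp only [A, Finset.mem_union, Finset.mem_filter, Finset.mem_univ, true_and, Adjacent,
      Bool.exists_bool, eq_comm]
  · have := Finset.card_union_le (A false) (A true)
    have := hA false
    have := hA true
    omega

theorem exists_pos_le (hρ : IsSymmetricAdmissible η ρ) : ∃ c : ℝ, 0 < c ∧ ∀ e, c ≤ ρ e := by
  have : ∀ᶠ c in 𝓝[>] (0 : ℝ), 0 < c ∧ ∀ e, c ≤ ρ e :=
    eventually_mem_nhdsWithin.and (eventually_all.2 fun e =>
      nhdsWithin_le_nhds (eventually_le_nhds (hρ.mem_Ioo e).1))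
  exact this.exists

theorem exists_le_lt_one (hρ : IsSymmetricAdmissible η ρ) :
    ∃ c : ℝ, 0 ≤ c ∧ c < 1 ∧ ∀ e, ρ e ≤ c := by
  have : ∀ᶠ c in 𝓝[<] (1 : ℝ), 0 ≤ c ∧ c < 1 ∧ ∀ e, ρ e ≤ c :=
    ((eventually_ge_nhds one_pos).filter_mono nhdsWithin_le_nhds).and
      (eventually_mem_nhdsWithin.and (eventually_all.2 fun e =>
        nhdsWithin_le_nhds (eventually_ge_nhds (hρ.mem_Ioo e).2)))
  exact this.exists

theorem cascade_le_pow (hρ : ∀ e, 0 < ρ e) (hcρ : ∀ e, ρ e ≤ c) (e : S.Edge n) :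
    S.cascade ρ n e ≤ c ^ (n + 1) := by
  induction n with
  | zero => simpa using! hcρ e
  | succ n ih =>
    rw [cascade_succ, pow_succ]
    exact mul_le_mul (ih _) (hcρ _) (hρ _).le ((cascade_pos hρ _).le.trans (ih (parent e)))

theorem tendsto_cascade (hρ : IsSymmetricAdmissible η ρ) (x : S.Symbol) :
    Tendsto (fun n => S.cascade ρ n (x.1 n)) atTop (𝓝 0) := by
  obtain ⟨c, hc₀, hc₁, hc⟩ := exists_le_lt_one hρ
  have hpos : ∀ e, 0 < ρ e := fun e => (hρ.mem_Ioo e).1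
  exact squeeze_zero (fun n => (cascade_pos hpos _).le) (fun n => cascade_le_pow hpos hc _)
    ((tendsto_pow_atTop_nhds_zero_of_lt_one hc₀ hc₁).comp (tendsto_add_atTop_nat 1))

/-! ### The limit metric -/

theorem monotone_edgeDist (hρ : IsSymmetricAdmissible η ρ) (x y : S.Symbol) :
    Monotone fun n => S.edgeDist ρ n (x.1 n) (y.1 n) := by
  refine monotone_nat_of_le_succ fun n => ?_
  have := edgeDist_parent_le (fun e => (hρ.mem_Ioo e).1) hρ.admissible (x.1 (n + 1)) (y.1 (n + 1))
  rwa [x.2, y.2] at this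

/-- An upper bound for the diameter of the limit space. -/
noncomputable def diamBound (ρ : S.gen.E → ℝ) : ℝ := ∑ e, ρ e + 2

theorem edgeDist_le_diamBound (hρ : IsSymmetricAdmissible η ρ) (x y : S.Symbol) (n : ℕ) :
    S.edgeDist ρ n (x.1 n) (y.1 n) ≤ diamBound ρ := by
  have hpos : ∀ e, 0 < ρ e := fun e => (hρ.mem_Ioo e).1
  have h₁ := edgeDist_le_add hpos x y (Nat.zero_le n)
  have h₂ := edgeDist_zero_le hpos (x.1 0) (y.1 0)
  have h₃ : S.cascade ρ 0 (x.1 0) ≤ 1 := (hρ.mem_Ioo _).2.le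
  have h₄ : S.cascade ρ 0 (y.1 0) ≤ 1 := (hρ.mem_Ioo _).2.le
  unfold diamBound
  linarith

/-- The pseudometric on symbols that induces the metric of the limit space. -/
noncomputable def symbolDist (ρ : S.gen.E → ℝ) (x y : S.Symbol) : ℝ :=
  ⨆ n, S.edgeDist ρ n (x.1 n) (y.1 n)

theorem tendsto_symbolDist (hρ : IsSymmetricAdmissible η ρ) (x y : S.Symbol) :
    Tendsto (fun n => S.edgeDist ρ n (x.1 n) (y.1 n)) atTop (𝓝 (symbolDist ρ x y)) :=
  tendsto_atTop_ciSup (monotone_edgeDist hρ x y)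
    ⟨_, Set.forall_mem_range.2 (edgeDist_le_diamBound hρ x y)⟩

theorem symbolDist_comm (hρ : IsSymmetricAdmissible η ρ) (x y : S.Symbol) :
    symbolDist ρ x y = symbolDist ρ y x := by
  simp only [symbolDist, fun n => edgeDist_comm (fun e => (hρ.mem_Ioo e).1) (x.1 n) (y.1 n)]

theorem symbolDist_triangle (hρ : IsSymmetricAdmissible η ρ) (x y z : S.Symbol) :
    symbolDist ρ x z ≤ symbolDist ρ x y + symbolDist ρ y z := by
  have h := ((tendsto_symbolDist hρ x y).add (tendsto_cascade hρ y)).add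
    (tendsto_symbolDist hρ y z)
  rw [add_zero] at h
  exact le_of_tendsto_of_tendsto' (tendsto_symbolDist hρ x z) h fun n =>
    edgeDist_triangle (fun e => (hρ.mem_Ioo e).1) _ _ _

theorem symbolDist_eq_zero_iff (hD : S.Doubling) (hρ : IsSymmetricAdmissible η ρ)
    {x y : S.Symbol} : symbolDist ρ x y = 0 ↔ S.symbolRel x y := by
  have hpos : ∀ e, 0 < ρ e := fun e => (hρ.mem_Ioo e).1
  constructor
  · intro h n
    by_contra hn
    obtain ⟨c, hc₀, hc⟩ := exists_pos_le hρ
    have h₁ := le_edgeDist_of_not_adjacent hD hρ hc₀.le hc hn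
    have h₂ := (monotone_edgeDist hρ x y).ge_of_tendsto (tendsto_symbolDist hρ x y) n
    have h₃ := mul_pos hc₀ (cascade_pos hpos (x.1 n))
    linarith
  · intro h
    simp only [symbolDist, fun n => edgeDist_eq_zero hpos (h n), ciSup_const]

theorem symbolDist_congr (hD : S.Doubling) (hρ : IsSymmetricAdmissible η ρ) (x : S.Symbol)
    {y z : S.Symbol} (h : S.symbolRel y z) : symbolDist ρ x y = symbolDist ρ x z := by
  have h₁ := (symbolDist_eq_zero_iff hD hρ).2 h
  have h₂ := symbolDist_triangle hρ x y z
  have h₃ := symbolDist_triangle hρ x z y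
  rw [symbolDist_comm hρ z y] at h₃
  linarith

/-- The limit metric `d_ρ`. -/
noncomputable abbrev limitMetric (hD : S.Doubling) (hρ : IsSymmetricAdmissible η ρ) :
    MetricSpace S.LimitSpace where
  dist := Quot.lift₂ (symbolDist ρ) (fun x _ _ h => symbolDist_congr hD hρ x h) fun x y z h => by
    rw [symbolDist_comm hρ x z, symbolDist_comm hρ y z]
    exact symbolDist_congr hD hρ z h
  dist_self := by
    rintro ⟨x⟩
    exact (symbolDist_eq_zero_iff hD hρ).2 fun n => Adjacent.refl _
  dist_comm := by
    rintro ⟨x⟩ ⟨y⟩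
    exact symbolDist_comm hρ x y
  dist_triangle := by
    rintro ⟨x⟩ ⟨y⟩ ⟨z⟩
    exact symbolDist_triangle hρ x y z
  eq_of_dist_eq_zero := by
    rintro ⟨x⟩ ⟨y⟩ h
    exact Quot.sound ((symbolDist_eq_zero_iff hD hρ).1 h)

theorem isLimitMetric_limitMetric (hD : S.Doubling) (hρ : IsSymmetricAdmissible η ρ) :
    S.IsLimitMetric ρ (limitMetric hD hρ) := fun x y => tendsto_symbolDist hρ x y

section Estimates

variable {d : MetricSpace S.LimitSpace}

theorem IsLimitMetric.edgeDist_le (hρ : IsSymmetricAdmissible η ρ) (hd : S.IsLimitMetric ρ d)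
    (x y : S.Symbol) (n : ℕ) :
    S.edgeDist ρ n (x.1 n) (y.1 n) ≤ d.dist (S.proj x) (S.proj y) :=
  (monotone_edgeDist hρ x y).ge_of_tendsto (hd x y) n

theorem IsLimitMetric.dist_le (hρ : IsSymmetricAdmissible η ρ) (hd : S.IsLimitMetric ρ d)
    (x y : S.Symbol) (n : ℕ) : d.dist (S.proj x) (S.proj y) ≤
      S.edgeDist ρ n (x.1 n) (y.1 n) + S.cascade ρ n (x.1 n) + S.cascade ρ n (y.1 n) :=
  le_of_tendsto (hd x y) ((eventually_ge_atTop n).mono fun _ hm =>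
    edgeDist_le_add (fun e => (hρ.mem_Ioo e).1) x y hm)

theorem IsLimitMetric.dist_le_diamBound (hρ : IsSymmetricAdmissible η ρ)
    (hd : S.IsLimitMetric ρ d) (x y : S.LimitSpace) : d.dist x y ≤ diamBound ρ := by
  obtain ⟨x, rfl⟩ := Quot.exists_rep x
  obtain ⟨y, rfl⟩ := Quot.exists_rep y
  exact le_of_tendsto' (hd x y) (edgeDist_le_diamBound hρ x y)

theorem IsLimitMetric.dist_le_two_mul (hρ : IsSymmetricAdmissible η ρ)
    (hd : S.IsLimitMetric ρ d) {x y : S.Symbol} {n : ℕ} (h : x.1 n = y.1 n) :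
    d.dist (S.proj x) (S.proj y) ≤ 2 * S.cascade ρ n (x.1 n) := by
  have h₁ := hd.dist_le hρ x y n
  rw [← h, edgeDist_eq_zero (fun e => (hρ.mem_Ioo e).1) (Adjacent.refl _)] at h₁
  linarith

/-- Symbols closer than the weight of an edge, up to a constant, have adjacent edges. -/
theorem IsLimitMetric.adjacent_of_dist_lt (hD : S.Doubling) (hρ : IsSymmetricAdmissible η ρ)
    (hd : S.IsLimitMetric ρ d) (hc : 0 ≤ c) (hcρ : ∀ e, c ≤ ρ e) {x y : S.Symbol} {n : ℕ}
    (h : d.dist (S.proj x) (S.proj y) < c * S.cascade ρ n (x.1 n)) :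
    (S.graph n).Adjacent (x.1 n) (y.1 n) := by
  by_contra hn
  exact ((le_edgeDist_of_not_adjacent hD hρ hc hcρ hn).trans (hd.edgeDist_le hρ x y n)).not_gt h

/-- The distance of two symbols is comparable to the weight at the first level at which their edges
are not adjacent. This level does not depend on the density. -/
theorem IsLimitMetric.dist_comparable (hD : S.Doubling) (hρ : IsSymmetricAdmissible η ρ)
    (hd : S.IsLimitMetric ρ d) : ∃ B : ℝ, 0 < B ∧ ∀ (x y : S.Symbol) (n : ℕ),
      ¬ (S.graph n).Adjacent (x.1 n) (y.1 n) →
      (∀ m < n, (S.graph m).Adjacent (x.1 m) (y.1 m)) →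
      S.cascade ρ n (x.1 n) ≤ B * d.dist (S.proj x) (S.proj y) ∧
        d.dist (S.proj x) (S.proj y) ≤ B * S.cascade ρ n (x.1 n) := by
  have hpos : ∀ e, 0 < ρ e := fun e => (hρ.mem_Ioo e).1
  obtain ⟨c, hc₀, hc⟩ := exists_pos_le hρ
  have hM : 0 < diamBound ρ :=
    add_pos_of_nonneg_of_pos (Finset.sum_nonneg fun e _ => (hpos e).le) two_pos
  obtain ⟨B, hB⟩ : ∃ B, B = c⁻¹ * (1 + diamBound ρ + (1 + c⁻¹)) := ⟨_, rfl⟩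
  have hci : 0 < c⁻¹ := inv_pos.2 hc₀
  refine ⟨B, by rw [hB]; positivity, fun x y n hn hm => ⟨?_, ?_⟩⟩
  · have h := (le_edgeDist_of_not_adjacent hD hρ hc₀.le hc hn).trans (hd.edgeDist_le hρ x y n)
    have h0 : 0 ≤ d.dist (S.proj x) (S.proj y) := dist_nonneg
    calc S.cascade ρ n (x.1 n) ≤ c⁻¹ * d.dist (S.proj x) (S.proj y) := by
          rwa [inv_mul_eq_div, le_div_iff₀' hc₀]
      _ ≤ B * d.dist (S.proj x) (S.proj y) := by
          refine mul_le_mul_of_nonneg_right ?_ h0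
          rw [hB]
          exact le_mul_of_one_le_right hci.le (by linarith)
  · cases n with
    | zero =>
      have h₁ : 1 ≤ c⁻¹ * S.cascade ρ 0 (x.1 0) := by
        rw [inv_mul_eq_div, one_le_div hc₀]; exact hc _
      calc d.dist (S.proj x) (S.proj y) ≤ diamBound ρ := hd.dist_le_diamBound hρ _ _
        _ ≤ (1 + diamBound ρ + (1 + c⁻¹)) * (c⁻¹ * S.cascade ρ 0 (x.1 0)) := by
            nlinarith
        _ = B * S.cascade ρ 0 (x.1 0) := by rw [hB]; ring
    | succ n =>
      have had := hm n (Nat.lt_succ_self n)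
      have h₁ := hd.dist_le hρ x y n
      rw [edgeDist_eq_zero hpos had] at h₁
      have h₂ : S.cascade ρ n (y.1 n) ≤ c⁻¹ * S.cascade ρ n (x.1 n) := by
        rw [inv_mul_eq_div, le_div_iff₀' hc₀]
        exact cascade_comparable hD hρ hc₀.le hc had.symm
      have h₃ : S.cascade ρ n (x.1 n) ≤ c⁻¹ * S.cascade ρ (n + 1) (x.1 (n + 1)) := by
        rw [inv_mul_eq_div, le_div_iff₀ hc₀, cascade_succ, x.2]
        exact mul_le_mul_of_nonneg_left (hc _) (cascade_pos hpos _).le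
      have h₄ := cascade_pos hpos (x.1 (n + 1))
      calc d.dist (S.proj x) (S.proj y) ≤ (1 + c⁻¹) * S.cascade ρ n (x.1 n) := by linarith
        _ ≤ (1 + c⁻¹) * (c⁻¹ * S.cascade ρ (n + 1) (x.1 (n + 1))) := by gcongr
        _ ≤ (1 + diamBound ρ + (1 + c⁻¹)) * (c⁻¹ * S.cascade ρ (n + 1) (x.1 (n + 1))) := by
            exact mul_le_mul_of_nonneg_right (by linarith) (by positivity)
        _ = B * S.cascade ρ (n + 1) (x.1 (n + 1)) := by rw [hB]; ring

end Estimates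

end SimpleIGS

/-! ### The exponent -/

namespace SimpleIGS

open OGraph

variable {S : SimpleIGS.{u}} {n : ℕ} {ρ : S.gen.E → ℝ} {η : S.Symmetry} {Q : ℝ}

theorem one_le_sum (hρ : IsSymmetricAdmissible η ρ) : 1 ≤ ∑ e, ρ e := by
  obtain ⟨i⟩ := S.nonempty_I
  exact one_le_sum_of_linked (fun e => (hρ.mem_Ioo e).1) hρ.admissible (s := false) (i := i) (j := i)
    ((linked_univ 0 _ _).mono fun e _ => Finset.mem_coe.2 (Finset.mem_univ (α := S.gen.E) e))

theorem nonempty_edge (hρ : IsSymmetricAdmissible η ρ) : Nonempty S.gen.E := by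
  by_contra h
  rw [not_nonempty_iff] at h
  have := one_le_sum hρ
  simp at this
  linarith

theorem exists_exponent (hρ : IsSymmetricAdmissible η ρ) : ∃ Q : ℝ, 1 ≤ Q ∧ ∑ e, ρ e ^ Q = 1 ∧
    ∀ Q' : ℝ, ∑ e, ρ e ^ Q' = 1 → Q' = Q := by
  have := nonempty_edge hρ
  have hanti : StrictAnti fun q : ℝ => ∑ e, ρ e ^ q := fun a b hab =>
    Finset.sum_lt_sum_of_nonempty Finset.univ_nonempty fun e _ =>
      Real.rpow_lt_rpow_of_exponent_gt (hρ.mem_Ioo e).1 (hρ.mem_Ioo e).2 hab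
  have hcont : Continuous fun q : ℝ => ∑ e, ρ e ^ q :=
    continuous_finsetSum _ fun e _ => Real.continuous_const_rpow (hρ.mem_Ioo e).1.ne'
  have hlim : Tendsto (fun q : ℝ => ∑ e, ρ e ^ q) atTop (𝓝 0) := by
    have := tendsto_finsetSum (Finset.univ : Finset S.gen.E) fun e _ =>
      tendsto_rpow_atTop_of_base_lt_one (ρ e) (by linarith [(hρ.mem_Ioo e).1]) (hρ.mem_Ioo e).2
    simpa using this
  obtain ⟨b, hb₁, hb⟩ := ((eventually_ge_atTop 1).and (hlim.eventually_le_const one_pos)).exists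
  obtain ⟨Q, hQ, h⟩ := intermediate_value_Icc' hb₁ hcont.continuousOn
    (show (1 : ℝ) ∈ Set.Icc _ _ from ⟨hb, by simpa using one_le_sum hρ⟩)
  exact ⟨Q, hQ.1, h, fun Q' h' => hanti.injective (h'.trans h.symm)⟩

/-! ### Words and cylinders -/

/-- Finite alphabets carry the discrete topology. -/
instance : TopologicalSpace S.gen.E := ⊥

instance : DiscreteTopology S.gen.E := ⟨rfl⟩

instance : BorelSpace S.gen.E := ⟨borel_eq_top_of_discrete.symm⟩

theorem word_eq_word_iff {v w : ℕ → S.gen.E} :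
    S.word v n = S.word w n ↔ ∀ k ∈ Finset.range (n + 1), v k = w k := by
  induction n with
  | zero => exact (by simp : v 0 = w 0 ↔ ∀ k ∈ Finset.range (0 + 1), v k = w k)
  | succ n ih =>
    rw [Finset.range_add_one, Finset.forall_mem_insert, ← ih]
    exact Prod.ext_iff

theorem exists_word (x : S.Symbol) : ∃ w, S.ofWord w = x := by
  let w : ℕ → S.gen.E := fun n => Nat.casesOn n (x.1 0) fun n => digit (x.1 (n + 1))
  refine ⟨w, Subtype.ext (funext fun n => ?_)⟩
  induction n with
  | zero => rfl
  | succ n ih => exact Prod.ext rfl (ih.trans (x.2 n).symm)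

theorem exists_word_eq (e : S.Edge n) : ∃ w, S.word w n = e := by
  induction n with
  | zero => exact ⟨fun _ => e, rfl⟩
  | succ n ih =>
    obtain ⟨w, hw⟩ := ih (parent e)
    classical
    refine ⟨Function.update w (n + 1) (digit e), Prod.ext (Function.update_self ..) ?_⟩
    refine Eq.trans (word_eq_word_iff.2 fun k hk => ?_) hw
    exact Function.update_of_ne (by have := Finset.mem_range.1 hk; omega) _ _

theorem cascade_word (ρ : S.gen.E → ℝ) (w : ℕ → S.gen.E) (n : ℕ) :
    S.cascade ρ n (S.word w n) = ∏ k ∈ Finset.range (n + 1), ρ (w k) := by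
  induction n with
  | zero => simp [cascade, word]
  | succ n ih =>
    rw [Finset.prod_range_succ, ← ih]
    rfl

theorem isProbabilityMeasure_letterLaw (hρ : ∀ e, 0 < ρ e) (hQ : ∑ e, ρ e ^ Q = 1) :
    IsProbabilityMeasure (S.letterLaw ρ Q) := by
  refine ⟨?_⟩
  simp only [letterLaw, Measure.coe_finsetSum, Finset.sum_apply, Measure.smul_apply,
    measure_univ, smul_eq_mul, mul_one]
  rw [← ENNReal.ofReal_sum_of_nonneg fun e _ => (Real.rpow_pos_of_pos (hρ e) Q).le, hQ,
    ENNReal.ofReal_one]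

theorem letterLaw_singleton (ρ : S.gen.E → ℝ) (Q : ℝ) (e : S.gen.E) :
    S.letterLaw ρ Q {e} = ENNReal.ofReal (ρ e ^ Q) := by
  classical
  simp only [letterLaw, Measure.coe_finsetSum, Finset.sum_apply, Measure.smul_apply,
    smul_eq_mul]
  rw [Finset.sum_eq_single e]
  · simp
  · intro b _ hb
    simp [Set.indicator, hb]
  · simp

theorem infinitePi_cylinder_word (hρ : ∀ e, 0 < ρ e) (hQ : ∑ e, ρ e ^ Q = 1) (e : S.Edge n) :
    Measure.infinitePi (fun _ : ℕ => S.letterLaw ρ Q) {v | S.word v n = e} =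
      ENNReal.ofReal (S.cascade ρ n e ^ Q) := by
  have := isProbabilityMeasure_letterLaw hρ hQ
  obtain ⟨w, rfl⟩ := exists_word_eq e
  have hset : {v | S.word v n = S.word w n} =
      Set.pi (Finset.range (n + 1) : Set ℕ) fun k => {w k} := by
    ext v
    simp only [Set.mem_ofPred_eq, word_eq_word_iff, Set.mem_pi, Finset.mem_coe,
      Set.mem_singleton_iff]
  rw [hset, Measure.infinitePi_pi _ fun _ _ => MeasurableSpace.measurableSet_top, cascade_word]
  simp only [letterLaw_singleton]
  rw [← ENNReal.ofReal_prod_of_nonneg fun k _ => (Real.rpow_pos_of_pos (hρ _) Q).le,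
    Real.finsetProd_rpow _ _ fun k _ => (hρ _).le]

section

variable {d : MetricSpace S.LimitSpace}

theorem IsLimitMetric.continuous_proj (hρ : IsSymmetricAdmissible η ρ) (hd : S.IsLimitMetric ρ d) :
    Continuous fun w => S.proj (S.ofWord w) := by
  refine Metric.continuous_iff'.2 fun w ε hε => ?_
  obtain ⟨n, hn⟩ := ((tendsto_cascade hρ (S.ofWord w)).eventually_lt_const (half_pos hε)).exists
  have hev : ∀ᶠ v in 𝓝 w, ∀ k ∈ Finset.range (n + 1), v k = w k :=
    (Finset.eventually_all _).2 fun k _ =>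
      (continuous_apply k).tendsto w ((isOpen_discrete {w k}).mem_nhds rfl)
  filter_upwards [hev] with v hv
  have h := hd.dist_le_two_mul hρ (x := S.ofWord w) (y := S.ofWord v) (n := n)
    (word_eq_word_iff.2 hv).symm
  rw [dist_comm]
  calc dist (S.proj (S.ofWord w)) (S.proj (S.ofWord v)) ≤ _ := h
    _ < ε := by linarith

theorem surjective_proj_ofWord : Function.Surjective fun w => S.proj (S.ofWord w) := by
  rintro ⟨x⟩
  obtain ⟨w, rfl⟩ := exists_word x
  exact ⟨w, rfl⟩

theorem IsLimitMetric.compactSpace (hρ : IsSymmetricAdmissible η ρ) (hd : S.IsLimitMetric ρ d) :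
    CompactSpace S.LimitSpace := by
  refine ⟨?_⟩
  rw [← surjective_proj_ofWord.range_eq]
  exact isCompact_range (hd.continuous_proj hρ)

/-- Along a word the weights decrease to zero with bounded ratios, so that they meet every scale. -/
theorem exists_cascade_lt (hρ : IsSymmetricAdmissible η ρ) {c : ℝ} (hc : 0 < c)
    (hcρ : ∀ e, c ≤ ρ e) (x : S.Symbol) {t T : ℝ} (ht : 0 < t) (htT : t ≤ T) (hT : 1 ≤ T) :
    ∃ n, S.cascade ρ n (x.1 n) < t ∧ c / T * t ≤ S.cascade ρ n (x.1 n) := by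
  classical
  have hex : ∃ n, S.cascade ρ n (x.1 n) < t :=
    ((tendsto_cascade hρ x).eventually_lt_const ht).exists
  refine ⟨Nat.find hex, Nat.find_spec hex, ?_⟩
  have hT₀ : 0 < T := one_pos.trans_le hT
  obtain ⟨m, hm⟩ : ∃ m, m = Nat.find hex := ⟨_, rfl⟩
  have hmin : ∀ k < m, t ≤ S.cascade ρ k (x.1 k) := fun k hk =>
    not_lt.1 (Nat.find_min hex (hm ▸ hk))
  rw [← hm]
  clear hm
  cases m with
  | zero =>
    calc c / T * t ≤ c / T * T := by gcongr
      _ = c := div_mul_cancel₀ _ hT₀.ne'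
      _ ≤ _ := hcρ _
  | succ m =>
    have h := hmin m (Nat.lt_succ_self m)
    rw [cascade_succ, x.2]
    calc c / T * t ≤ c * t := by
          refine mul_le_mul_of_nonneg_right (div_le_self hc.le hT) ht.le
      _ ≤ _ := by
          rw [mul_comm]
          exact mul_le_mul h (hcρ _) hc.le (ht.le.trans h)

/-! ### Ahlfors regularity -/

theorem IsLimitMetric.isAhlforsRegularMeasure (hD : S.Doubling) (hρ : IsSymmetricAdmissible η ρ)
    (hd : S.IsLimitMetric ρ d) (hQ₁ : 1 ≤ Q) (hQ : ∑ e, ρ e ^ Q = 1) :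
    IsAhlforsRegularMeasure d Q (S.limitMeasure ρ Q d) := by
  let _ : MeasurableSpace S.LimitSpace := borel S.LimitSpace
  have : BorelSpace S.LimitSpace := ⟨rfl⟩
  have hpos : ∀ e, 0 < ρ e := fun e => (hρ.mem_Ioo e).1
  have hQ₀ : 0 ≤ Q := zero_le_one.trans hQ₁
  have hprob := isProbabilityMeasure_letterLaw hpos hQ
  have hcompact := hd.compactSpace hρ
  have hmeas : Measurable fun w => S.proj (S.ofWord w) := (hd.continuous_proj hρ).measurable
  have hμ : S.limitMeasure ρ Q d = Measure.map (fun w => S.proj (S.ofWord w))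
    (Measure.infinitePi fun _ : ℕ => S.letterLaw ρ Q) := rfl
  have hμprob : IsProbabilityMeasure (S.limitMeasure ρ Q d) := by
    rw [hμ]; exact Measure.isProbabilityMeasure_map hmeas.aemeasurable
  refine ⟨inferInstance, ?_⟩
  have hball : ∀ x r, S.limitMeasure ρ Q d (Metric.ball x r) =
      Measure.infinitePi (fun _ : ℕ => S.letterLaw ρ Q)
        ((fun w => S.proj (S.ofWord w)) ⁻¹' Metric.ball x r) := fun x r => by
    rw [hμ]; exact Measure.map_apply hmeas Metric.isOpen_ball.measurableSet
  obtain ⟨c, hc₀, hc⟩ := exists_pos_le hρ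
  have hc₁ : c ≤ 1 := by
    obtain ⟨e⟩ := nonempty_edge hρ
    exact (hc e).trans (hρ.mem_Ioo e).2.le
  obtain ⟨M, hM⟩ : ∃ M, M = diamBound ρ := ⟨_, rfl⟩
  have hM₁ : 1 ≤ M := by
    have := one_le_sum hρ
    rw [hM, diamBound]; linarith
  have hM₀ : 0 < M := one_pos.trans_le hM₁
  obtain ⟨N, hN⟩ : ∃ N : ℕ, N = 2 * Fintype.card S.gen.E := ⟨_, rfl⟩
  obtain ⟨C₁, hC₁⟩ : ∃ C₁, C₁ = (c / (2 * M)) ^ Q := ⟨_, rfl⟩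
  obtain ⟨C₂, hC₂⟩ : ∃ C₂, C₂ = (N + 1) * ((c ^ 3)⁻¹) ^ Q := ⟨_, rfl⟩
  have hC₁₀ : 0 < C₁ := hC₁ ▸ Real.rpow_pos_of_pos (by positivity) _
  have hC₂₀ : 0 < C₂ := by rw [hC₂]; positivity
  refine ⟨1 + C₁⁻¹ + C₂, by linarith [inv_pos.2 hC₁₀], fun x r hr hrd => ?_⟩
  obtain ⟨w, rfl⟩ := surjective_proj_ofWord x
  rw [hball]
  constructor
  · -- the ball contains the cylinder of an edge of comparable weight
    have hrM : r ≤ 2 * M := by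
      have h₁ : Metric.ediam (Set.univ : Set S.LimitSpace) ≤ ENNReal.ofReal M :=
        Metric.ediam_le fun y _ z _ => by
          rw [edist_dist]
          exact ENNReal.ofReal_le_ofReal (hM ▸ hd.dist_le_diamBound hρ y z)
      have h₂ : ENNReal.ofReal r ≤ ENNReal.ofReal (2 * M) := by
        rw [ENNReal.ofReal_mul two_pos.le, ENNReal.ofReal_ofNat]
        exact hrd.trans (mul_le_mul_right h₁ 2)
      exact (ENNReal.ofReal_le_ofReal_iff (by positivity)).1 h₂
    obtain ⟨n, hn₁, hn₂⟩ := exists_cascade_lt hρ hc₀ hc (S.ofWord w) (half_pos hr)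
      (show r / 2 ≤ M by linarith) hM₁
    calc ENNReal.ofReal ((1 + C₁⁻¹ + C₂)⁻¹ * r ^ Q) ≤
          ENNReal.ofReal (S.cascade ρ n (S.word w n) ^ Q) := by
          refine ENNReal.ofReal_le_ofReal ?_
          calc (1 + C₁⁻¹ + C₂)⁻¹ * r ^ Q ≤ C₁ * r ^ Q := by
                refine mul_le_mul_of_nonneg_right ?_ (Real.rpow_nonneg hr.le _)
                exact inv_le_of_inv_le₀ hC₁₀ (by linarith)
            _ = (c / M * (r / 2)) ^ Q := by
                rw [hC₁, ← Real.mul_rpow (by positivity) hr.le]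
                congr 1
                field_simp
            _ ≤ _ := Real.rpow_le_rpow (by positivity) hn₂ hQ₀
      _ = Measure.infinitePi (fun _ : ℕ => S.letterLaw ρ Q) {v | S.word v n = S.word w n} :=
          (infinitePi_cylinder_word hpos hQ _).symm
      _ ≤ _ := by
          refine measure_mono fun v hv => ?_
          have h := hd.dist_le_two_mul hρ (x := S.ofWord v) (y := S.ofWord w) (n := n) hv
          have hv' : S.cascade ρ n ((S.ofWord v).1 n) < r / 2 := by
            rw [show (S.ofWord v).1 n = (S.ofWord w).1 n from hv]; exact hn₁
          exact h.trans_lt (by linarith)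
  · refine le_trans ?_ (ENNReal.ofReal_le_ofReal (mul_le_mul_of_nonneg_right
      (show C₂ ≤ 1 + C₁⁻¹ + C₂ by linarith [inv_pos.2 hC₁₀]) (Real.rpow_nonneg hr.le Q)))
    have hC₂r : C₂ * r ^ Q = (N + 1) * (r / c ^ 3) ^ Q := by
      rw [hC₂, mul_assoc, ← Real.mul_rpow (by positivity) hr.le, inv_mul_eq_div]
    rcases le_or_gt (c ^ 2) r with hcr | hcr
    · -- large balls
      refine prob_le_one.trans ?_
      rw [hC₂r, ENNReal.one_le_ofReal]
      have h₁ : 1 ≤ r / c ^ 3 := by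
        rw [one_le_div (by positivity)]
        exact (pow_le_pow_of_le_one hc₀.le hc₁ (by norm_num)).trans hcr
      have h₂ := Real.one_le_rpow h₁ hQ₀
      have h₃ : (0 : ℝ) ≤ N := N.cast_nonneg
      nlinarith
    · -- small balls lie in the star of an edge of comparable weight
      obtain ⟨n, hn₁, hn₂⟩ := exists_cascade_lt hρ hc₀ hc (S.ofWord w) (t := r / c ^ 2)
        (by positivity) ((div_le_one (by positivity)).2 hcr.le) le_rfl
      obtain ⟨T, hT, hTcard⟩ := exists_finset_adjacent hD (S.word w n)
      have hrn : r ≤ c * S.cascade ρ n (S.word w n) := by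
        calc r = c * (c / 1 * (r / c ^ 2)) := by field_simp
          _ ≤ _ := mul_le_mul_of_nonneg_left hn₂ hc₀.le
      have hsub : (fun w => S.proj (S.ofWord w)) ⁻¹' Metric.ball (S.proj (S.ofWord w)) r ⊆
          ⋃ e ∈ T, {v | S.word v n = e} := by
        intro v hv
        simp only [Set.mem_iUnion, Set.mem_ofPred_eq, exists_prop, exists_eq_right']
        have hv' : dist (S.proj (S.ofWord w)) (S.proj (S.ofWord v)) < r := by
          rw [dist_comm]; exact hv
        exact (hT _).2 (hd.adjacent_of_dist_lt hD hρ hc₀.le hc (hv'.trans_le hrn))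
      refine (measure_mono hsub).trans ((measure_biUnion_finset_le _ _).trans ?_)
      have hterm : ∀ e ∈ T, Measure.infinitePi (fun _ : ℕ => S.letterLaw ρ Q)
          {v | S.word v n = e} ≤ ENNReal.ofReal ((r / c ^ 3) ^ Q) := by
        intro e he
        rw [infinitePi_cylinder_word hpos hQ]
        refine ENNReal.ofReal_le_ofReal (Real.rpow_le_rpow (cascade_pos hpos _).le ?_ hQ₀)
        have h₁ := cascade_comparable hD hρ hc₀.le hc ((hT e).1 he).symm
        calc S.cascade ρ n e ≤ S.cascade ρ n (S.word w n) / c := by rwa [le_div_iff₀' hc₀]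
          _ ≤ r / c ^ 2 / c := by
            have := hn₁.le
            gcongr
            exact this
          _ = r / c ^ 3 := by field_simp
      refine (Finset.sum_le_sum hterm).trans ?_
      rw [Finset.sum_const, nsmul_eq_mul, hC₂r, ENNReal.ofReal_mul (by positivity)]
      refine mul_le_mul_left ?_ _
      rw [← ENNReal.ofReal_natCast]
      refine ENNReal.ofReal_le_ofReal ?_
      have : (T.card : ℝ) ≤ N := by rw [hN]; exact_mod_cast hTcard
      linarith

end

end SimpleIGS

/-! ### Quasisymmetry -/

/-- A sum of two increasing power functions is a homeomorphism of the half-line. -/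
theorem exists_homeomorph_rpow_add_rpow {A D : ℝ≥0} {α β : ℝ} (hA : 0 < A) (hD : 0 < D)
    (hα : 0 < α) (hβ : 0 < β) :
    ∃ θ : ℝ≥0 ≃ₜ ℝ≥0, ∀ t, θ t = A * ((D * t) ^ α + (D * t) ^ β) := by
  let f : ℝ≥0 → ℝ≥0 := fun t => A * ((D * t) ^ α + (D * t) ^ β)
  have hmono : StrictMono f := fun a b hab => by
    have h : D * a < D * b := mul_lt_mul_of_pos_left hab hD
    exact mul_lt_mul_of_pos_left (add_lt_add (NNReal.rpow_lt_rpow h hα) (NNReal.rpow_lt_rpow h hβ))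
      hA
  have hcont : Continuous f := by
    have h : Continuous fun t : ℝ≥0 => D * t := continuous_const.mul continuous_id
    exact continuous_const.mul (((NNReal.continuous_rpow_const hα.le).comp h).add
      ((NNReal.continuous_rpow_const hβ.le).comp h))
  have hsurj : Function.Surjective f := by
    intro y
    have h₀ : f 0 = 0 := by simp [f, hα.ne', hβ.ne']
    have hb : y ≤ f ((y / A) ^ α⁻¹ / D) := by
      have h₁ : (D * ((y / A) ^ α⁻¹ / D)) ^ α = y / A := by
        rw [mul_div_cancel₀ _ hD.ne', NNReal.rpow_inv_rpow hα.ne']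
      calc y = A * (y / A) := (mul_div_cancel₀ _ hA.ne').symm
        _ ≤ _ := mul_le_mul_right (h₁.symm.le.trans le_self_add) A
    obtain ⟨t, -, ht⟩ := intermediate_value_Icc (zero_le) hcont.continuousOn
      (show y ∈ Set.Icc _ _ from ⟨by rw [h₀]; exact zero_le, hb⟩)
    exact ⟨t, ht⟩
  exact ⟨(hmono.orderIsoOfSurjective f hsurj).toHomeomorph, fun _ => rfl⟩

namespace SimpleIGS

open OGraph

variable {S : SimpleIGS.{u}} {n : ℕ} {ρ ν : S.gen.E → ℝ} {η : S.Symmetry} {α β : ℝ}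

theorem exists_le_rpow (hρ : IsSymmetricAdmissible η ρ) (hν : IsSymmetricAdmissible η ν) :
    ∃ α : ℝ, 0 < α ∧ ∀ e, ν e ≤ ρ e ^ α := by
  have : ∀ᶠ α in 𝓝[>] (0 : ℝ), 0 < α ∧ ∀ e, ν e ≤ ρ e ^ α := by
    refine eventually_mem_nhdsWithin.and (eventually_all.2 fun e => nhdsWithin_le_nhds ?_)
    have h := (Real.continuous_const_rpow (hρ.mem_Ioo e).1.ne').tendsto 0
    rw [Real.rpow_zero] at h
    exact h.eventually_const_le (hν.mem_Ioo e).2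
  exact this.exists

theorem exists_rpow_le (hρ : IsSymmetricAdmissible η ρ) (hν : IsSymmetricAdmissible η ν) :
    ∃ β : ℝ, 0 < β ∧ ∀ e, ρ e ^ β ≤ ν e := by
  have : ∀ᶠ β : ℝ in atTop, 0 < β ∧ ∀ e, ρ e ^ β ≤ ν e := by
    refine (eventually_gt_atTop 0).and (eventually_all.2 fun e => ?_)
    exact (tendsto_rpow_atTop_of_base_lt_one (ρ e) (by linarith [(hρ.mem_Ioo e).1])
      (hρ.mem_Ioo e).2).eventually_le_const (hν.mem_Ioo e).1
  exact this.exists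

theorem antitone_cascade_div (hρ : ∀ e, 0 < ρ e) (hν : ∀ e, 0 < ν e)
    (h : ∀ e, ν e ≤ ρ e ^ α) (x : S.Symbol) :
    Antitone fun n => S.cascade ν n (x.1 n) / S.cascade ρ n (x.1 n) ^ α := by
  refine antitone_nat_of_succ_le fun n => ?_
  rw [cascade_succ, cascade_succ, x.2, Real.mul_rpow (cascade_pos hρ _).le (hρ _).le,
    mul_div_mul_comm]
  exact mul_le_of_le_one_right (div_pos (cascade_pos hν _)
    (Real.rpow_pos_of_pos (cascade_pos hρ _) _)).le
    ((div_le_one (Real.rpow_pos_of_pos (hρ _) _)).2 (h _))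

theorem monotone_cascade_div (hρ : ∀ e, 0 < ρ e) (hν : ∀ e, 0 < ν e)
    (h : ∀ e, ρ e ^ β ≤ ν e) (x : S.Symbol) :
    Monotone fun n => S.cascade ν n (x.1 n) / S.cascade ρ n (x.1 n) ^ β := by
  refine monotone_nat_of_le_succ fun n => ?_
  rw [cascade_succ, cascade_succ, x.2, Real.mul_rpow (cascade_pos hρ _).le (hρ _).le,
    mul_div_mul_comm]
  exact le_mul_of_one_le_right (div_pos (cascade_pos hν _)
    (Real.rpow_pos_of_pos (cascade_pos hρ _) _)).le
    ((one_le_div (Real.rpow_pos_of_pos (hρ _) _)).2 (h _))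

/-- Ratios of weights along a symbol for two densities control each other. -/
theorem cascade_div_cascade_le (hρ : ∀ e, 0 < ρ e) (hν : ∀ e, 0 < ν e)
    (hα : ∀ e, ν e ≤ ρ e ^ α) (hβ : ∀ e, ρ e ^ β ≤ ν e) (x : S.Symbol) (n m : ℕ) :
    S.cascade ν n (x.1 n) / S.cascade ν m (x.1 m) ≤
      (S.cascade ρ n (x.1 n) / S.cascade ρ m (x.1 m)) ^ α +
        (S.cascade ρ n (x.1 n) / S.cascade ρ m (x.1 m)) ^ β := by
  have hρn := cascade_pos hρ (x.1 n)
  have hρm := cascade_pos hρ (x.1 m)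
  have hνm := cascade_pos hν (x.1 m)
  have hr := div_pos hρn hρm
  -- both monotonicity statements give this shape
  have key : ∀ γ : ℝ, S.cascade ν n (x.1 n) / S.cascade ρ n (x.1 n) ^ γ ≤
      S.cascade ν m (x.1 m) / S.cascade ρ m (x.1 m) ^ γ →
      S.cascade ν n (x.1 n) / S.cascade ν m (x.1 m) ≤
        (S.cascade ρ n (x.1 n) / S.cascade ρ m (x.1 m)) ^ γ := by
    intro γ h
    rw [Real.div_rpow hρn.le hρm.le]
    rw [div_le_div_iff₀ (Real.rpow_pos_of_pos hρn _) (Real.rpow_pos_of_pos hρm _)] at h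
    rw [div_le_div_iff₀ hνm (Real.rpow_pos_of_pos hρm _)]
    linarith
  rcases le_total m n with hmn | hnm
  · exact (key α (antitone_cascade_div hρ hν hα x hmn)).trans
      (le_add_of_nonneg_right (Real.rpow_nonneg hr.le _))
  · exact (key β (monotone_cascade_div hρ hν hβ x hnm)).trans
      (le_add_of_nonneg_left (Real.rpow_nonneg hr.le _))

theorem cascade_le_cascade_rpow (hρ : ∀ e, 0 < ρ e) (hν : ∀ e, 0 < ν e)
    (hα : ∀ e, ν e ≤ ρ e ^ α) (x : S.Symbol) (n : ℕ) :
    S.cascade ν n (x.1 n) ≤ S.cascade ρ n (x.1 n) ^ α := by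
  rw [← div_le_one (Real.rpow_pos_of_pos (cascade_pos hρ _) _)]
  exact (antitone_cascade_div hρ hν hα x (Nat.zero_le n)).trans
    ((div_le_one (Real.rpow_pos_of_pos (hρ _) _)).2 (hα _))

/-- Distinct points have a first level at which their edges are not adjacent. -/
theorem exists_separation_level {x y : S.Symbol} (h : S.proj x ≠ S.proj y) :
    ∃ n, ¬ (S.graph n).Adjacent (x.1 n) (y.1 n) ∧
      ∀ m < n, (S.graph m).Adjacent (x.1 m) (y.1 m) := by
  classical
  have hex : ∃ n, ¬ (S.graph n).Adjacent (x.1 n) (y.1 n) := by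
    by_contra! hall
    exact h (Quot.sound hall)
  exact ⟨Nat.find hex, Nat.find_spec hex, fun m hm => not_not.1 (Nat.find_min hex hm)⟩

variable {d d' : MetricSpace S.LimitSpace}

theorem IsLimitMetric.continuous_identity (hD : S.Doubling) (hρ : IsSymmetricAdmissible η ρ)
    (hν : IsSymmetricAdmissible η ν) (hd : S.IsLimitMetric ρ d) (hd' : S.IsLimitMetric ν d') :
    @Continuous S.LimitSpace S.LimitSpace d.toUniformSpace.toTopologicalSpace
      d'.toUniformSpace.toTopologicalSpace id := by
  have hρ₀ : ∀ e, 0 < ρ e := fun e => (hρ.mem_Ioo e).1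
  have hν₀ : ∀ e, 0 < ν e := fun e => (hν.mem_Ioo e).1
  obtain ⟨α, hα₀, hα⟩ := exists_le_rpow hρ hν
  obtain ⟨B, hB, hdist⟩ := hd.dist_comparable hD hρ
  obtain ⟨B', hB', hdist'⟩ := hd'.dist_comparable hD hν
  -- the identity is Hölder continuous
  have hholder : ∀ p q : S.LimitSpace, d'.dist p q ≤ B' * (B * d.dist p q) ^ α := by
    rintro ⟨x⟩ ⟨y⟩
    have h0 : 0 ≤ d.dist (S.proj x) (S.proj y) := @dist_nonneg _ d.toPseudoMetricSpace _ _
    by_cases hxy : S.proj x = S.proj y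
    · have h : d'.dist (S.proj x) (S.proj y) = 0 := by rw [hxy]; exact d'.dist_self _
      exact h.le.trans (mul_nonneg hB'.le (Real.rpow_nonneg (mul_nonneg hB.le h0) _))
    · obtain ⟨n, hn, hm⟩ := exists_separation_level hxy
      calc d'.dist (S.proj x) (S.proj y) ≤ B' * S.cascade ν n (x.1 n) := (hdist' x y n hn hm).2
        _ ≤ B' * (S.cascade ρ n (x.1 n)) ^ α :=
            mul_le_mul_of_nonneg_left (cascade_le_cascade_rpow hρ₀ hν₀ hα x n) hB'.le
        _ ≤ B' * (B * d.dist (S.proj x) (S.proj y)) ^ α :=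
            mul_le_mul_of_nonneg_left (Real.rpow_le_rpow (cascade_pos hρ₀ _).le
              (hdist x y n hn hm).1 hα₀.le) hB'.le
  have hlim : Tendsto (fun t : ℝ => B' * (B * t) ^ α) (𝓝 0) (𝓝 0) := by
    have h : Continuous fun t : ℝ => B' * (B * t) ^ α :=
      continuous_const.mul ((continuous_const.mul continuous_id).rpow_const fun _ => Or.inr hα₀.le)
    simpa [Real.zero_rpow hα₀.ne'] using h.tendsto 0
  refine (@Metric.continuous_iff _ _ d.toPseudoMetricSpace d'.toPseudoMetricSpace _).2
    fun p ε hε => ?_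
  obtain ⟨δ, hδ, h⟩ := Metric.eventually_nhds_iff.1 (hlim.eventually_lt_const hε)
  refine ⟨δ, hδ, fun q hq => (hholder q p).trans_lt (h ?_)⟩
  rw [Real.dist_0_eq_abs, abs_of_nonneg (@dist_nonneg _ d.toPseudoMetricSpace _ _)]
  exact hq

theorem IsLimitMetric.quasisymmetricallyEquivalent (hD : S.Doubling)
    (hρ : IsSymmetricAdmissible η ρ) (hν : IsSymmetricAdmissible η ν)
    (hd : S.IsLimitMetric ρ d) (hd' : S.IsLimitMetric ν d') :
    QuasisymmetricallyEquivalent d d' := by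
  have hρ₀ : ∀ e, 0 < ρ e := fun e => (hρ.mem_Ioo e).1
  have hν₀ : ∀ e, 0 < ν e := fun e => (hν.mem_Ioo e).1
  refine ⟨?_, ?_⟩
  · refine @IsHomeomorph.mk _ _ d.toUniformSpace.toTopologicalSpace
      d'.toUniformSpace.toTopologicalSpace _ (hd.continuous_identity hD hρ hν hd') ?_
      Function.bijective_id
    intro U hU
    rw [Set.image_id]
    exact @Continuous.isOpen_preimage _ _ d'.toUniformSpace.toTopologicalSpace
      d.toUniformSpace.toTopologicalSpace _ (hd'.continuous_identity hD hν hρ hd) U hU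
  obtain ⟨α, hα₀, hα⟩ := exists_le_rpow hρ hν
  obtain ⟨β, hβ₀, hβ⟩ := exists_rpow_le hρ hν
  obtain ⟨B, hB, hdist⟩ := hd.dist_comparable hD hρ
  obtain ⟨B', hB', hdist'⟩ := hd'.dist_comparable hD hν
  obtain ⟨θ, hθ⟩ := exists_homeomorph_rpow_add_rpow (A := (B' ^ 2).toNNReal)
    (D := (B ^ 2).toNNReal) (by simpa using pow_pos hB' 2) (by simpa using pow_pos hB 2) hα₀ hβ₀
  refine ⟨θ, ?_⟩
  rintro ⟨x⟩ ⟨y⟩ ⟨z⟩ hxz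
  change S.proj x ≠ S.proj z at hxz
  have key : d'.dist (S.proj x) (S.proj y) / d'.dist (S.proj x) (S.proj z) ≤
      B' ^ 2 * ((B ^ 2 * (d.dist (S.proj x) (S.proj y) / d.dist (S.proj x) (S.proj z))) ^ α +
        (B ^ 2 * (d.dist (S.proj x) (S.proj y) / d.dist (S.proj x) (S.proj z))) ^ β) := by
    have h₀ : 0 ≤ d.dist (S.proj x) (S.proj y) := @dist_nonneg _ d.toPseudoMetricSpace _ _
    have h₁ : 0 < d.dist (S.proj x) (S.proj z) := (@dist_pos _ d _ _).2 hxz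
    have h₁' : 0 < d'.dist (S.proj x) (S.proj z) := (@dist_pos _ d' _ _).2 hxz
    by_cases hxy : S.proj x = S.proj y
    · have h : d'.dist (S.proj x) (S.proj y) = 0 := by rw [hxy]; exact d'.dist_self _
      rw [h, zero_div]
      positivity
    obtain ⟨n, hn, hn'⟩ := exists_separation_level hxy
    obtain ⟨m, hm, hm'⟩ := exists_separation_level hxz
    obtain ⟨ha, -⟩ := hdist x y n hn hn'
    obtain ⟨-, hb⟩ := hdist x z m hm hm'
    obtain ⟨-, ha'⟩ := hdist' x y n hn hn'
    obtain ⟨hb', -⟩ := hdist' x z m hm hm'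
    have hρm := cascade_pos hρ₀ (x.1 m)
    have hνm := cascade_pos hν₀ (x.1 m)
    have hρn := cascade_pos hρ₀ (x.1 n)
    have hνn := cascade_pos hν₀ (x.1 n)
    have e₁ : d'.dist (S.proj x) (S.proj y) / d'.dist (S.proj x) (S.proj z) ≤
        B' ^ 2 * (S.cascade ν n (x.1 n) / S.cascade ν m (x.1 m)) := by
      rw [← mul_div_assoc, div_le_div_iff₀ h₁' hνm]
      calc _ ≤ (B' * S.cascade ν n (x.1 n)) * (B' * d'.dist (S.proj x) (S.proj z)) :=
            mul_le_mul ha' hb' hνm.le (by positivity)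
        _ = _ := by ring
    have e₂ : S.cascade ρ n (x.1 n) / S.cascade ρ m (x.1 m) ≤
        B ^ 2 * (d.dist (S.proj x) (S.proj y) / d.dist (S.proj x) (S.proj z)) := by
      rw [← mul_div_assoc, div_le_div_iff₀ hρm h₁]
      calc _ ≤ (B * d.dist (S.proj x) (S.proj y)) * (B * S.cascade ρ m (x.1 m)) :=
            mul_le_mul ha hb h₁.le (by positivity)
        _ = _ := by ring
    refine e₁.trans (mul_le_mul_of_nonneg_left ?_ (by positivity))
    refine (cascade_div_cascade_le hρ₀ hν₀ hα hβ x n m).trans (add_le_add ?_ ?_)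
    · exact Real.rpow_le_rpow (by positivity) e₂ hα₀.le
    · exact Real.rpow_le_rpow (by positivity) e₂ hβ₀.le
  rw [hθ, ← NNReal.coe_le_coe]
  simpa [Real.coe_toNNReal _ (sq_nonneg B), Real.coe_toNNReal _ (sq_nonneg B')] using! key

end SimpleIGS

/-- Let `X` be the limit space of a simple iterated graph system that is doubling, non-degenerate
and symmetric with symmetry map `η`. -/
theorem theorem1p2 (S : SimpleIGS.{u}) (hD : S.Doubling) (hN : S.NonDegenerate)
    (η : S.Symmetry) :
    (∀ ρ : S.gen.E → ℝ, SimpleIGS.IsSymmetricAdmissible η ρ →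
      ∃ Q : ℝ, (1 ≤ Q ∧ ∑ e, ρ e ^ Q = 1 ∧ ∀ Q' : ℝ, ∑ e, ρ e ^ Q' = 1 → Q' = Q) ∧
        ∃ d : MetricSpace S.LimitSpace, S.IsLimitMetric ρ d ∧
          IsAhlforsRegular d Q ∧ IsAhlforsRegularMeasure d Q (S.limitMeasure ρ Q d)) ∧
    (∀ ρ ν : S.gen.E → ℝ, SimpleIGS.IsSymmetricAdmissible η ρ →
      SimpleIGS.IsSymmetricAdmissible η ν →
      ∀ d d' : MetricSpace S.LimitSpace, S.IsLimitMetric ρ d → S.IsLimitMetric ν d' →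
        QuasisymmetricallyEquivalent d d') := by
  refine ⟨fun ρ hρ => ?_, fun ρ ν hρ hν d d' hd hd' =>
    hd.quasisymmetricallyEquivalent hD hρ hν hd'⟩
  obtain ⟨Q, hQ₁, hQ, huniq⟩ := SimpleIGS.exists_exponent hρ
  have hd := SimpleIGS.isLimitMetric_limitMetric hD hρ
  have hreg := hd.isAhlforsRegularMeasure hD hρ hQ₁ hQ
  exact ⟨Q, ⟨hQ₁, hQ, huniq⟩, _, hd, ⟨one_pos.trans_le hQ₁, _, hreg⟩, hreg⟩
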